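/- Let $k \ge 0$ and let $I=(i_1,\dots,i_k)$ and $J=(j_1,\dots,j_k)$ be two sequences of positive integers, each with distinct entries. For $n \ge \max(i_1,\dots,i_k,j_1,\dots,j_k)$ let $\mathbf{1}_{I,J}\colon \mathfrak{S}_n \to \mathbb{C}$ be the indicator function of the set of permutations $w$ of $\{1,\dots,n\}$ with $w(i_p)=j_p$ for all $p=1,\dots,k$; let $R$ be the Reynolds operator $(Rf)(w)=\frac{1}{n!}\sum_{v\in\mathfrak{S}_n} f(v^{-1}wv)$; let $\mathrm{ch}_n(f)=\frac{1}{n!}\sum_{w\in\mathfrak{S}_n} f(w)\,p_{\mathrm{cyc}(w)}$ be the Frobenius characteristic of a class function $f$, where $\mathrm{cyc}(w)\vdash n$ is the cycle type of $w$ and $p_\mu$ is the power sum symmetric function; and let $$A_{n,I,J} := n!\cdot \mathrm{ch}_n(R\,\mathbf{1}_{I,J}).$$ For a partition $\lambda=(\lambda_1\ge\lambda_2\ge\cdots)$ and $n\ge|\lambda|+\lambda_1$ let $\lambda[n]:=(n-|\lambda|,\lambda_1,\lambda_2,\dots)\vdash n$, and let $s_\mu$ denote the Schur function of a partition $\mu$.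 Then there are polynomials $c_\lambda$ in one variable with complex coefficients, one for each partition $\lambda$ with $|\lambda|\le k$, depending on $(I,J)$ but not on $n$, such that $\deg c_\lambda\le k-|\lambda|$ and such that for every integer $n\ge\max(i_1,\dots,i_k,j_1,\dots,j_k,2k)$ $$A_{n,I,J} = (n-\#(I\cup J))!\cdot\sum_{|\lambda|\le k} c_\lambda(n)\, s_{\lambda[n]},$$ where $\#(I\cup J)$ is the number of distinct integers occurring in $I$ or $J$. -/

import Mathlib

open scoped Nat

noncomputable section

namespace SymFun

open MvPolynomial Equiv

/-! ### The ring of symmetric functions -/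

/-- The specialization `f(x₁, …, x_N, x_{N+1}) ↦ f(x₁, …, x_N, 0)`. -/
def setLastZero (N : ℕ) : MvPolynomial (Fin (N + 1)) ℂ →ₐ[ℂ] MvPolynomial (Fin N) ℂ :=
  aeval fun i => if h : (i : ℕ) < N then X ⟨i, h⟩ else 0

/-- The ring `Λ` of symmetric functions over `ℂ` in infinitely many variables `x₁, x₂, …`.
A symmetric function `f` is given by the compatible family of symmetric polynomials
`f(x₁, …, x_N) = f(x₁, …, x_N, 0, 0, …)`, `N = 0, 1, 2, …`, of bounded degree. -/
def Lambda : Subalgebra ℂ (∀ N : ℕ, MvPolynomial (Fin N) ℂ) where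
  carrier := {f | (∀ N, (f N).IsSymmetric) ∧ (∀ N, setLastZero N (f (N + 1)) = f N) ∧
    ∃ d : ℕ, ∀ N, (f N).totalDegree ≤ d}
  mul_mem' := by
    rintro f g ⟨hf, hf', d, hd⟩ ⟨hg, hg', e, he⟩
    refine ⟨fun N => (hf N).mul (hg N), fun N => by simp [hf', hg'], d + e, fun N => ?_⟩
    exact (totalDegree_mul _ _).trans (add_le_add (hd N) (he N))
  add_mem' := by
    rintro f g ⟨hf, hf', d, hd⟩ ⟨hg, hg', e, he⟩
    refine ⟨fun N => (hf N).add (hg N), fun N => by simp [hf', hg'], max d e, fun N => ?_⟩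
    exact (totalDegree_add _ _).trans (max_le_max (hd N) (he N))
  algebraMap_mem' r := by
    refine ⟨fun N => ?_, fun N => ?_, 0, fun N => ?_⟩
    · exact IsSymmetric.C r
    · exact (setLastZero N).commutes r
    · exact (totalDegree_C r).le

/-- The power sum symmetric function `p_d = x₁ᵈ + x₂ᵈ + ⋯` for `d > 0`. -/
def powerSum (d : ℕ) (hd : 0 < d) : Lambda :=
  ⟨fun N => psum (Fin N) ℂ d, by
    refine ⟨fun N => psum_isSymmetric _ _ d, fun N => ?_, d, fun N => ?_⟩
    · simp only [psum, Fin.sum_univ_castSucc, map_add, map_sum, map_pow, setLastZero, aeval_X]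
      simp [hd.ne']
    · exact totalDegree_finsetSum_le fun i _ => by simp [totalDegree_X_pow]⟩

/-- The power sum symmetric function `p_μ = p_{μ₁} p_{μ₂} ⋯` of a partition `μ`. -/
def powerSumPartition {n : ℕ} (μ : n.Partition) : Lambda :=
  (μ.parts.pmap powerSum fun _ h => μ.parts_pos h).prod

/-! ### Partitions and Schur functions -/

/-- The length of row `i` (counted from `0`) of the partition `μ`, that is the part `μ_{i+1}` of
`μ = (μ₁ ≥ μ₂ ≥ ⋯)`, with trailing zeros. -/
def row {n : ℕ} (μ : n.Partition) (i : ℕ) : ℕ :=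
  (μ.parts.sort (· ≥ ·)).getD i 0

/-- The alternant `ε · x^β = ∑_w sign(w) w · x^β` in the variables `x₁, …, x_N`. -/
def alternant (N : ℕ) (β : Fin N → ℕ) : MvPolynomial (Fin N) ℂ :=
  ∑ w : Perm (Fin N), (Perm.sign w : ℤ) • rename w (∏ i, X i ^ β i)

/-- The staircase `δ = (N - 1, …, 1, 0)`. -/
def delta (N : ℕ) (i : Fin N) : ℕ := N - 1 - i

/-- The exponent vector `μ + δ`. -/
def addDelta (N : ℕ) {n : ℕ} (μ : n.Partition) (i : Fin N) : ℕ := row μ i + delta N i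

theorem alternant_eq_det (N : ℕ) (β : Fin N → ℕ) :
    alternant N β = (Matrix.of fun i j => (X i : MvPolynomial (Fin N) ℂ) ^ β j).det := by
  simp [alternant, Matrix.det_apply, Units.smul_def]

theorem alternant_delta (N : ℕ) :
    alternant N (delta N) = ((Perm.sign (Fin.revPerm : Perm (Fin N)) : ℤ) :
      MvPolynomial (Fin N) ℂ) * (Matrix.vandermonde X).det := by
  rw [alternant_eq_det, ← Matrix.det_permute']
  congr 1
  ext1 i j
  simp [Matrix.vandermonde, delta, Fin.rev]
  congr 1; omega

theorem alternant_delta_ne_zero (N : ℕ) : alternant N (delta N) ≠ 0 := by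
  rw [alternant_delta]
  refine mul_ne_zero ?_ (Matrix.det_vandermonde_ne_zero_iff.2 (X_injective))
  rcases Int.units_eq_one_or (Perm.sign (Fin.revPerm : Perm (Fin N))) with h | h <;> simp [h]

theorem irreducible_X_sub_X {N : ℕ} {i j : Fin N} (h : i ≠ j) :
    Irreducible (X i - X j : MvPolynomial (Fin N) ℂ) := by
  have hne : (X i - X j : MvPolynomial (Fin N) ℂ) ≠ 0 :=
    sub_ne_zero.2 fun h' => h (X_injective h')
  have hc : coeff (Finsupp.single i 1) (X i - X j : MvPolynomial (Fin N) ℂ) = 1 := by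
    have h' : (Finsupp.single j 1 : Fin N →₀ ℕ) ≠ Finsupp.single i 1 := fun h' =>
      h (Finsupp.single_left_injective one_ne_zero h').symm
    rw [coeff_sub, coeff_X, coeff_X, if_pos rfl, if_neg h', sub_zero]
  refine irreducible_of_totalDegree_eq_one ?_ fun x hx => ?_
  · exact ((isHomogeneous_X ℂ i).sub (isHomogeneous_X ℂ j)).totalDegree hne
  · exact isUnit_of_dvd_one (hc ▸ hx (Finsupp.single i 1))

theorem X_sub_X_dvd_alternant {N : ℕ} (β : Fin N → ℕ) {i j : Fin N} (h : i ≠ j) :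
    (X i - X j : MvPolynomial (Fin N) ℂ) ∣ alternant N β := by
  rw [← Ideal.mem_span_singleton, ← Ideal.Quotient.eq_zero_iff_mem, alternant_eq_det,
    RingHom.map_det]
  refine Matrix.det_zero_of_row_eq h ?_
  have : Ideal.Quotient.mk (Ideal.span {(X i - X j : MvPolynomial (Fin N) ℂ)}) (X i) =
      Ideal.Quotient.mk _ (X j) := by
    rw [Ideal.Quotient.eq]; exact Ideal.mem_span_singleton_self _
  funext l
  simp [this]

/-- The alternant `a_δ` divides every alternant, so bialternants are polynomials. -/
theorem alternant_delta_dvd (N : ℕ) (β : Fin N → ℕ) : alternant N (delta N) ∣ alternant N β := by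
  have key : (Matrix.vandermonde (X : Fin N → MvPolynomial (Fin N) ℂ)).det ∣ alternant N β := by
    rw [Matrix.det_vandermonde, Finset.prod_sigma']
    refine Finset.prod_dvd_of_isRelPrime ?_ ?_
    · rintro ⟨a, b⟩ hab ⟨c, d⟩ hcd hne
      have hab' : a < b := by simpa using hab
      have hcd' : c < d := by simpa using hcd
      simp only [Function.onFun]
      rw [(irreducible_X_sub_X hab'.ne').isRelPrime_iff_not_dvd]
      rintro ⟨q, hq⟩
      have h1 := congrArg (aeval fun i : Fin N => if i = b then (X a : MvPolynomial (Fin N) ℂ)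
        else X i) hq
      simp only [map_sub, map_mul, aeval_X, if_true, if_neg hab'.ne, sub_self, zero_mul] at h1
      rw [sub_eq_zero] at h1
      split_ifs at h1 with h2 h3 h3
      · exact hcd'.ne (h3.trans h2.symm)
      · exact hne (by rw [X_injective h1, h2])
      · have := X_injective h1
        subst h3 this
        exact absurd hab' hcd'.not_gt
      · exact hcd'.ne' (X_injective h1)
    · rintro ⟨a, b⟩ hab
      have hab' : a < b := by simpa using hab
      exact X_sub_X_dvd_alternant β hab'.ne'
  rw [alternant_delta]
  rcases Int.units_eq_one_or (Perm.sign (Fin.revPerm : Perm (Fin N))) with h | h <;>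
    simpa [h] using key

/-- The Schur polynomial `s_μ(x₁, …, x_N) = a_{μ+δ} / a_δ`; it is zero when `μ` has more than `N`
parts. -/
def schurPoly (N : ℕ) {n : ℕ} (μ : n.Partition) : MvPolynomial (Fin N) ℂ :=
  if μ.parts.card ≤ N then (alternant_delta_dvd N (addDelta N μ)).choose else 0

theorem alternant_mul_schurPoly {N n : ℕ} (μ : n.Partition) (h : μ.parts.card ≤ N) :
    alternant N (delta N) * schurPoly N μ = alternant N (addDelta N μ) := by
  rw [schurPoly, if_pos h]
  exact (alternant_delta_dvd N (addDelta N μ)).choose_spec.symm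

theorem rename_alternant {N : ℕ} (β : Fin N → ℕ) (σ : Perm (Fin N)) :
    rename σ (alternant N β) = ((Perm.sign σ : ℤ) : MvPolynomial (Fin N) ℂ) * alternant N β := by
  rw [alternant_eq_det, ← Matrix.det_permute]
  rw [AlgHom.map_det]
  congr 1
  ext1 i j
  simp

theorem schurPoly_isSymmetric (N : ℕ) {n : ℕ} (μ : n.Partition) : (schurPoly N μ).IsSymmetric := by
  by_cases h : μ.parts.card ≤ N
  · intro σ
    have h1 := congrArg (rename σ) (alternant_mul_schurPoly μ h)
    rw [map_mul, rename_alternant, rename_alternant, ← alternant_mul_schurPoly μ h, mul_assoc] at h1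
    have h2 : ((Perm.sign σ : ℤ) : MvPolynomial (Fin N) ℂ) ≠ 0 := by
      rcases Int.units_eq_one_or (Perm.sign σ) with h | h <;> simp [h]
    exact mul_left_cancel₀ (alternant_delta_ne_zero N) (mul_left_cancel₀ h2 h1)
  · rw [schurPoly, if_neg h]
    exact IsSymmetric.zero

theorem row_eq_zero_iff {n : ℕ} (μ : n.Partition) (i : ℕ) : row μ i = 0 ↔ μ.parts.card ≤ i := by
  constructor
  · intro h
    by_contra hlt
    have hl : i < (μ.parts.sort (· ≥ ·)).length := by simpa using hlt
    rw [row, List.getD_eq_getElem _ _ hl] at h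
    have hm : (μ.parts.sort (· ≥ ·))[i] ∈ μ.parts := by
      rw [← Multiset.mem_sort (r := (· ≥ ·))]; exact List.getElem_mem hl
    exact (μ.parts_pos hm).ne' h
  · intro h
    rw [row, List.getD_eq_default]
    simpa using h

theorem sum_row_le {n : ℕ} (μ : n.Partition) (N : ℕ) : ∑ i : Fin N, row μ i ≤ n := by
  have h : ∀ (l : List ℕ) (N : ℕ), ∑ i : Fin N, l.getD i 0 ≤ l.sum := by
    intro l
    induction l with
    | nil => simp
    | cons a l ih =>
      rintro (_ | N)
      · simp
      · simpa [Fin.sum_univ_succ] using ih N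
  have h2 := h (μ.parts.sort (· ≥ ·)) N
  rwa [← Multiset.sum_coe, Multiset.sort_eq, μ.parts_sum] at h2

theorem alternant_isHomogeneous {N : ℕ} (β : Fin N → ℕ) :
    (alternant N β).IsHomogeneous (∑ i, β i) := by
  refine IsHomogeneous.sum _ _ _ fun w _ => ?_
  have h : (rename w (∏ i, X i ^ β i : MvPolynomial (Fin N) ℂ)).IsHomogeneous (∑ i, β i) := by
    refine IsHomogeneous.rename_isHomogeneous (IsHomogeneous.prod _ _ _ fun i _ => ?_)
    simpa using (isHomogeneous_X ℂ i).pow (β i)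
  rcases Int.units_eq_one_or (Perm.sign w) with h' | h' <;> simp only [h']
  · simpa using h
  · simpa using h.neg

theorem totalDegree_schurPoly_le (N : ℕ) {n : ℕ} (μ : n.Partition) :
    (schurPoly N μ).totalDegree ≤ n := by
  by_cases hs : schurPoly N μ = 0
  · simp [hs]
  by_cases h : μ.parts.card ≤ N
  · have h1 := congrArg totalDegree (alternant_mul_schurPoly μ h)
    rw [totalDegree_mul_of_isDomain (alternant_delta_ne_zero N) hs,
      (alternant_isHomogeneous _).totalDegree (alternant_delta_ne_zero N)] at h1
    have h2 := (alternant_isHomogeneous (addDelta N μ)).totalDegree_le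
    have h3 := sum_row_le μ N
    simp only [addDelta, Finset.sum_add_distrib] at h1 h2
    omega
  · simp [schurPoly, h]

/-- Setting the last variable to zero in an alternant whose exponents before the last one are
positive. -/
theorem setLastZero_alternant {N : ℕ} (β : Fin (N + 1) → ℕ) (hβ : ∀ i : Fin N, 0 < β i.castSucc) :
    setLastZero N (alternant (N + 1) β) =
      if β (Fin.last N) = 0 then
        (∏ i, X i) * alternant N (fun i => β i.castSucc - 1) else 0 := by
  have hX : ∀ i : Fin N, setLastZero N (X i.castSucc) = X i := fun i => by simp [setLastZero]
  have hL : setLastZero N (X (Fin.last N)) = 0 := by simp [setLastZero]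
  rw [alternant_eq_det, AlgHom.map_det, Matrix.det_succ_row _ (Fin.last N),
    Finset.sum_eq_single (Fin.last N)]
  · by_cases h0 : β (Fin.last N) = 0
    · rw [if_pos h0, alternant_eq_det, ← Matrix.det_mul_column]
      have he : ((-1 : MvPolynomial (Fin N) ℂ)) ^ ((Fin.last N : Fin (N + 1)).val +
          (Fin.last N : Fin (N + 1)).val) = 1 := Even.neg_one_pow ⟨_, rfl⟩
      rw [he]
      simp only [AlgHom.mapMatrix_apply, Matrix.map_apply, Matrix.of_apply, h0, pow_zero, map_one,
        one_mul]
      congr 1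
      ext1 i j
      simp only [Matrix.submatrix_apply, Matrix.map_apply, Matrix.of_apply, Fin.succAbove_last,
        map_pow, hX]
      rw [← pow_succ', Nat.sub_add_cancel (hβ j)]
    · simp [hL, h0]
  · intro j _ hj
    obtain ⟨i, rfl⟩ := Fin.exists_castSucc_eq.2 hj
    simp [hL, (hβ i).ne']
  · simp

theorem setLastZero_schurPoly (N : ℕ) {n : ℕ} (μ : n.Partition) :
    setLastZero N (schurPoly (N + 1) μ) = schurPoly N μ := by
  have hP : (∏ i, X i : MvPolynomial (Fin N) ℂ) ≠ 0 :=
    Finset.prod_ne_zero_iff.2 fun i _ => X_ne_zero i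
  have hd : setLastZero N (alternant (N + 1) (delta (N + 1))) =
      (∏ i, X i) * alternant N (delta N) := by
    rw [setLastZero_alternant _ (fun i => by simp [delta]), if_pos (by simp [delta])]
    congr 2
    funext i
    simp only [delta, Fin.val_castSucc]
    omega
  by_cases h : μ.parts.card ≤ N + 1
  · have h1 := congrArg (setLastZero N) (alternant_mul_schurPoly μ h)
    rw [map_mul, hd, setLastZero_alternant _ (fun i => by
      have := i.2
      simp only [addDelta, delta, Fin.val_castSucc]; omega)] at h1
    by_cases h' : μ.parts.card ≤ N
    · have hr := (row_eq_zero_iff μ N).2 h'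
      rw [if_pos (by simp [addDelta, delta, hr])] at h1
      have he : (fun i : Fin N => addDelta (N + 1) μ i.castSucc - 1) = addDelta N μ := by
        funext i
        simp only [addDelta, delta, Fin.val_castSucc]
        have := i.2
        omega
      rw [he, ← alternant_mul_schurPoly μ h', mul_assoc] at h1
      exact mul_left_cancel₀ (alternant_delta_ne_zero N) (mul_left_cancel₀ hP h1)
    · have hr := (row_eq_zero_iff μ N).not.2 h'
      rw [if_neg (by simp [addDelta, delta, hr])] at h1
      rw [schurPoly, schurPoly, if_neg h', ← schurPoly]
      rcases mul_eq_zero.1 h1 with h2 | h2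
      · exact absurd h2 (mul_ne_zero hP (alternant_delta_ne_zero N))
      · exact h2
  · rw [schurPoly, schurPoly, if_neg h, if_neg (by omega), map_zero]

/-- The Schur function `s_μ`, the limit of the bialternants `a_{μ+δ} / a_δ` as `N → ∞`. -/
def schur {n : ℕ} (μ : n.Partition) : Lambda :=
  ⟨fun N => schurPoly N μ, fun N => schurPoly_isSymmetric N μ,
    fun N => setLastZero_schurPoly N μ, n, fun N => totalDegree_schurPoly_le N μ⟩

/-- The padded partition `μ[n] = (n - |μ|, μ₁, μ₂, …)` of `n`, defined for `n ≥ |μ| + μ₁`. -/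
def padded {j : ℕ} (μ : j.Partition) (n : ℕ) (h : j + row μ 0 ≤ n) : n.Partition :=
  Nat.Partition.ofSums n ((n - j) ::ₘ μ.parts) (by
    rw [Multiset.sum_cons, μ.parts_sum]; omega)

/-- If `|μ| ≤ k` and `n ≥ 2k` then `μ[n]` is defined. -/
theorem add_row_zero_le {k n j : ℕ} (μ : j.Partition) (hj : j < k + 1) (hn : 2 * k ≤ n) :
    j + row μ 0 ≤ n := by
  have h : row μ 0 ≤ j := by simpa using sum_row_le μ 1
  omega

/-! ### Symmetric groups and atomic symmetric functions -/

/-- The symmetric group `𝔖_n` of permutations of `[n] = {1, …, n}`. -/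
abbrev SymGroup (n : ℕ) : Type := Perm (Finset.Icc 1 n)

/-- The space of complex class functions on a group `G`. -/
def ClassFun (G : Type) [Group G] : Submodule ℂ (G → ℂ) where
  carrier := {f | ∀ g h : G, f (h * g * h⁻¹) = f g}
  add_mem' hf hg a b := by simp [hf a b, hg a b]
  zero_mem' a b := rfl
  smul_mem' c f hf a b := by simp [hf a b]

/-- The Reynolds operator `(R f)(w) = (1 / n!) ∑_v f(v⁻¹ w v)`. -/
def reynolds (n : ℕ) (f : SymGroup n → ℂ) : ClassFun (SymGroup n) :=
  ⟨fun w => 1 / (n ! : ℂ) * ∑ v : SymGroup n, f (v⁻¹ * w * v), fun g h => by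
    change 1 / (n ! : ℂ) * ∑ v : SymGroup n, f (v⁻¹ * (h * g * h⁻¹) * v) =
      1 / (n ! : ℂ) * ∑ v : SymGroup n, f (v⁻¹ * g * v)
    congr 1
    refine Fintype.sum_equiv (Equiv.mulLeft h⁻¹ : Perm (SymGroup n)) _ _ fun v => ?_
    simp [mul_assoc]⟩

/-- The Frobenius characteristic `ch_n(f) = (1 / n!) ∑_w f(w) p_{cyc(w)}`. The partition
`w.partition` lists the lengths of all cycles of `w`, including its fixed points. -/
def frobeniusCh (n : ℕ) (f : ClassFun (SymGroup n)) : Lambda :=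
  (1 / (n ! : ℂ)) • ∑ w : SymGroup n, (f : SymGroup n → ℂ) w • powerSumPartition w.partition

open Classical in
/-- The indicator `1_{I,J}` of the permutations `w` with `w(i_p) = j_p` for all `p`. -/
def indicator (n : ℕ) {k : ℕ} (I J : Fin k → Finset.Icc 1 n) (w : SymGroup n) : ℂ :=
  if ∀ p, w (I p) = J p then 1 else 0

/-- The atomic symmetric function `A_{n,I,J} = n! · ch_n(R 1_{I,J})`. -/
def atomic (n : ℕ) {k : ℕ} (I J : Fin k → Finset.Icc 1 n) : Lambda :=
  (n ! : ℂ) • frobeniusCh n (reynolds n (indicator n I J))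

end SymFun

end

noncomputable section

namespace SymFun

open MvPolynomial Equiv

/-! ### Partitions and their rows -/

/-! Let `E` be the set of pairs (i_p, j_p). Power sums are constant on conjugacy classes, so
averaging over conjugates changes nothing: A_{n,I,J} is the sum of p_{cyc(w)} over the permutations
w of [n] that extend `E` (`atomic_eq_extensionSum`). View `E` as a directed graph with k edges, a
disjoint union of cycles and paths, and induct on its number m of vertices (`exists_stablyExpands`).

If there are only cycles, `E` is a permutation σ of its m = k vertices, and an extension is σ
together with an arbitrary permutation of the other n - k points. The sum is then (n-k)! p_{cyc(σ)}
h_{n-k} (`extensionSum_of_perm`). The factor p_{cyc(σ)} does not depend on n and is a combination of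
Schur functions of degree k (`exists_sum_schur`). For n ≥ 2k, Pieri's rule writes h_{n-k} s_λ as the
sum of the s_{ρ[n]} with λ/ρ a horizontal strip (`complete_mul_schurPoly`), so the coefficients are
constants.

If some path ends with an edge x → y, delete that edge to get `E'` and classify the extensions of
`E'` by the image z of x (`extensionSum_erase`). An isolated vertex z, or z = y, gives the same sum
as `E`, by conjugation; there are n - m + 1 such z. A z that already has an incoming edge gives
nothing. Each z that starts a path gives a graph with k edges on m - 1 vertices. Solving for the sum
of `E` divides by n - m + 1, which turns (n-m+1)! into (n-m)!. The graph `E'` has k - 1 edges and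
either m - 1 or m - 2 vertices. In the latter case its prefactor is (n-m+2)! = (n-m+2)(n-m+1)!, and
the extra linear factor is paid for by the missing edge. This is why the degrees stay at most k -
|λ|. -/

/-- In a weakly decreasing list the zeros form a tail, so dropping them shifts no entry.
`Nat.Partition.ofSums` drops them. -/
theorem getD_filter_ne_zero (l : List ℕ) (hl : l.Pairwise (· ≥ ·)) (i : ℕ) :
    (l.filter (· ≠ 0)).getD i 0 = l.getD i 0 := by
  induction l generalizing i with
  | nil => simp
  | cons a l ih =>
    rw [List.pairwise_cons] at hl
    by_cases ha : a = 0
    · have h0 : ∀ b ∈ l, b = 0 := fun b hb => by have := hl.1 b hb; omega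
      have h1 : l.filter (· ≠ 0) = [] := by simpa using h0
      subst ha
      rw [List.filter_cons_of_neg (by simp), h1]
      cases i with
      | zero => simp
      | succ i => rw [List.getD_cons_succ, ← ih hl.2, h1]; simp
    · rw [List.filter_cons_of_pos (by simpa using ha)]
      cases i with
      | zero => simp
      | succ i => rw [List.getD_cons_succ, List.getD_cons_succ, ih hl.2]

theorem row_ofSums {n : ℕ} (l : List ℕ) (hl : l.Pairwise (· ≥ ·)) (hs : (l : Multiset ℕ).sum = n)
    (i : ℕ) : row (Nat.Partition.ofSums n l hs) i = l.getD i 0 := by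
  rw [← getD_filter_ne_zero l hl, row]
  congr 1
  have h1 : (Nat.Partition.ofSums n l hs).parts = (l.filter (· ≠ 0) : List ℕ) := by
    simp [Nat.Partition.ofSums]
  rw [h1, Multiset.coe_sort]
  exact List.mergeSort_eq_self _ (hl.filter _ |>.imp (by simp))

theorem row_padded {j : ℕ} (μ : j.Partition) (n : ℕ) (h : j + row μ 0 ≤ n) :
    row (padded μ n h) 0 = n - j ∧ ∀ i, row (padded μ n h) (i + 1) = row μ i := by
  have hs : ((n - j) :: μ.parts.sort (· ≥ ·) : List ℕ).Pairwise (· ≥ ·) := by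
    rw [List.pairwise_cons]
    refine ⟨fun b hb => ?_, Multiset.pairwise_sort _ _⟩
    have hp := Multiset.pairwise_sort μ.parts (· ≥ ·)
    have hb' : b ≤ row μ 0 := by
      rw [row]
      cases hL : μ.parts.sort (· ≥ ·) with
      | nil => simp [hL] at hb
      | cons a l =>
        rw [hL] at hb hp
        rw [List.pairwise_cons] at hp
        rcases List.mem_cons.1 hb with rfl | hb
        · simp
        · simpa using hp.1 b hb
    omega
  have he : padded μ n h = Nat.Partition.ofSums n
      ((n - j) :: μ.parts.sort (· ≥ ·) : List ℕ) (by
        rw [← Multiset.cons_coe, Multiset.sort_eq, Multiset.sum_cons, μ.parts_sum]; omega) := by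
    unfold padded
    congr 1
    rw [← Multiset.cons_coe, Multiset.sort_eq]
  rw [he]
  refine ⟨?_, fun i => ?_⟩
  · rw [row_ofSums _ hs]; simp
  · rw [row_ofSums _ hs, List.getD_cons_succ, row]

theorem row_antitone {n : ℕ} (μ : n.Partition) : Antitone (row μ) := by
  refine antitone_nat_of_succ_le fun i => ?_
  by_cases h : i + 1 < (μ.parts.sort (· ≥ ·)).length
  · rw [row, row, List.getD_eq_getElem _ _ h, List.getD_eq_getElem _ _ (by omega)]
    exact List.pairwise_iff_getElem.1 (Multiset.pairwise_sort μ.parts (· ≥ ·)) i (i + 1) _ _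
      (by omega)
  · rw [row, List.getD_eq_default _ _ (by omega)]
    exact Nat.zero_le _

theorem parts_eq_of_row_eq {n m : ℕ} (μ : n.Partition) (ν : m.Partition)
    (h : ∀ i, row μ i = row ν i) : μ.parts = ν.parts := by
  have hc : μ.parts.card = ν.parts.card := by
    apply le_antisymm
    · rw [← row_eq_zero_iff, h, row_eq_zero_iff]
    · rw [← row_eq_zero_iff, ← h, row_eq_zero_iff]
  rw [← Multiset.sort_eq μ.parts (· ≥ ·), ← Multiset.sort_eq ν.parts (· ≥ ·)]
  congr 1
  refine List.ext_getElem (by simpa using hc) fun i h1 h2 => ?_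
  have := h i
  rwa [row, row, List.getD_eq_getElem _ _ h1, List.getD_eq_getElem _ _ h2] at this

theorem sigma_eq_of_row_eq {n m : ℕ} (μ : n.Partition) (ν : m.Partition)
    (h : ∀ i, row μ i = row ν i) : (⟨n, μ⟩ : Σ n : ℕ, n.Partition) = ⟨m, ν⟩ := by
  have hp := parts_eq_of_row_eq μ ν h
  have hn : n = m := by rw [← μ.parts_sum, hp, ν.parts_sum]
  subst hn
  rw [Nat.Partition.ext hp]

theorem exists_partition_row (N : ℕ) (r : ℕ → ℕ) (hr : Antitone r) (hN : ∀ i, N ≤ i → r i = 0)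
    {d : ℕ} (hd : ∑ i : Fin N, r i = d) : ∃ μ : d.Partition, ∀ i, row μ i = r i := by
  subst hd
  refine ⟨Nat.Partition.ofSums _ ((List.range N).map r : List ℕ) ?_, fun i => ?_⟩
  · rw [Multiset.sum_coe, ← Finset.sum_range]
    rfl
  · rw [row_ofSums]
    · by_cases h : i < N
      · simp [List.getD, h]
      · simp [List.getD, h, hN i (by omega)]
    · rw [List.pairwise_map]
      exact List.pairwise_lt_range.imp fun h => hr h.le

theorem card_parts_le {n : ℕ} (μ : n.Partition) : μ.parts.card ≤ n := by
  have := Multiset.card_nsmul_le_sum (s := μ.parts) (a := 1) fun x hx => μ.parts_pos hx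
  simpa [μ.parts_sum] using this

theorem sum_row_eq {n : ℕ} (μ : n.Partition) {N : ℕ} (h : μ.parts.card ≤ N) :
    ∑ i : Fin N, row μ i = n := by
  have hl : ∀ (l : List ℕ) (N : ℕ), l.length ≤ N → ∑ i : Fin N, l.getD i 0 = l.sum := by
    intro l
    induction l with
    | nil => simp
    | cons a l ih =>
      rintro (_ | N) h
      · simp at h
      · simpa [Fin.sum_univ_succ] using ih N (by simpa using h)
  have h2 := hl (μ.parts.sort (· ≥ ·)) N (by simpa using h)
  rwa [← Multiset.sum_coe, Multiset.sort_eq, μ.parts_sum] at h2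

/-! ### Schur functions span the symmetric functions -/

theorem alternant_comp_perm {N : ℕ} (β : Fin N → ℕ) (σ : Perm (Fin N)) :
    alternant N (β ∘ σ) = ((Perm.sign σ : ℤ) : MvPolynomial (Fin N) ℂ) * alternant N β := by
  rw [alternant_eq_det, alternant_eq_det, ← Matrix.det_permute']
  rfl

theorem alternant_eq_zero {N : ℕ} (β : Fin N → ℕ) (h : ¬ Function.Injective β) :
    alternant N β = 0 := by
  simp only [Function.Injective, not_forall] at h
  obtain ⟨i, j, hij, hne⟩ := h
  rw [alternant_eq_det]
  exact Matrix.det_zero_of_column_eq hne fun l => by simp [hij]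

/-- Sort the exponents decreasingly. A strictly decreasing sequence of naturals dominates the
staircase, and subtracting the staircase leaves a weakly decreasing one. -/
theorem exists_addDelta_eq {N d : ℕ} (β : Fin N → ℕ) (hβ : Function.Injective β)
    (hd : ∑ i, β i = d + ∑ i, delta N i) :
    ∃ (σ : Perm (Fin N)) (μ : d.Partition), β ∘ σ = addDelta N μ := by
  obtain ⟨σ, hσ⟩ : ∃ σ : Perm (Fin N), StrictAnti (β ∘ σ) := by
    refine ⟨Fin.revPerm.trans (Tuple.sort β), ?_⟩
    have h1 : StrictMono (β ∘ Tuple.sort β) :=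
      (Tuple.monotone_sort β).strictMono_of_injective (hβ.comp (Tuple.sort β).injective)
    intro i j hij
    exact h1 (Fin.rev_lt_rev.2 hij)
  set γ : Fin N → ℕ := β ∘ σ with hγ
  -- Strict decrease costs at least one per step. This yields both γ ≥ δ and the monotonicity of γ -
  -- δ.
  have hstep : ∀ (t : ℕ) (i j : Fin N), (i : ℕ) + t = j → γ j + t ≤ γ i := by
    intro t
    induction t with
    | zero => intro i j h; have : i = j := Fin.ext (by simpa using h); simp [this]
    | succ t ih =>
      intro i j h
      have hl : (i : ℕ) + t < N := by have := j.2; omega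
      have h1 := ih i ⟨i + t, hl⟩ rfl
      have h2 : γ j < γ ⟨i + t, hl⟩ := hσ (by rw [Fin.lt_def]; simp; omega)
      omega
  have hge : ∀ i : Fin N, delta N i ≤ γ i := by
    intro i
    have hN := i.2
    have := hstep (N - 1 - i) i ⟨N - 1, by omega⟩ (by simp; omega)
    simp only [delta]; omega
  have hsum : ∑ i : Fin N, (fun i => if h : i < N then γ ⟨i, h⟩ - delta N ⟨i, h⟩ else 0) (i : ℕ)
      = d := by
    have h1 : ∑ i, γ i = ∑ i, β i := Equiv.sum_comp σ β
    have h2 : ∑ i, (γ i - delta N i) + ∑ i, delta N i = ∑ i, γ i := by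
      rw [← Finset.sum_add_distrib]
      exact Finset.sum_congr rfl fun i _ => Nat.sub_add_cancel (hge i)
    simp only [Fin.is_lt, dif_pos, Fin.eta]
    omega
  obtain ⟨μ, hμ⟩ := exists_partition_row N
    (fun i => if h : i < N then γ ⟨i, h⟩ - delta N ⟨i, h⟩ else 0) (by
      intro i j hij
      by_cases hj : j < N
      · have hi : i < N := by omega
        have := hstep (j - i) ⟨i, hi⟩ ⟨j, hj⟩ (by simp; omega)
        simp only [hi, hj, dif_pos, delta]
        omega
      · simp [hj]) (fun i hi => by rw [dif_neg (by omega)]) hsum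
  refine ⟨σ, μ, ?_⟩
  funext i
  have := hge i
  change γ i = _
  simp only [addDelta, hμ, i.2, dif_pos, Fin.eta]
  omega

theorem alternant_mem_span {N d : ℕ} (β : Fin N → ℕ) (hd : ∑ i, β i = d + ∑ i, delta N i) :
    alternant N β ∈ Submodule.span ℂ
      (Set.range fun μ : d.Partition => alternant N (addDelta N μ)) := by
  by_cases hβ : Function.Injective β
  · obtain ⟨σ, μ, h⟩ := exists_addDelta_eq β hβ hd
    have h1 : alternant N (addDelta N μ) ∈ Submodule.span ℂ
      (Set.range fun μ : d.Partition => alternant N (addDelta N μ)) :=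
      Submodule.subset_span ⟨μ, rfl⟩
    rw [← h, alternant_comp_perm] at h1
    rcases Int.units_eq_one_or (Perm.sign σ) with h' | h'
    · simpa [h'] using h1
    · simpa [h'] using h1
  · rw [alternant_eq_zero β hβ]
    exact zero_mem _

/-- Antisymmetrization is linear and sends each monomial to an alternant of the same degree. -/
theorem sum_sign_rename_mem_span {N d : ℕ} (g : MvPolynomial (Fin N) ℂ)
    (hg : g.IsHomogeneous (d + ∑ i, delta N i)) :
    ∑ w : Perm (Fin N), (Perm.sign w : ℤ) • rename w g ∈ Submodule.span ℂ
      (Set.range fun μ : d.Partition => alternant N (addDelta N μ)) := by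
  have h1 : ∑ w : Perm (Fin N), (Perm.sign w : ℤ) • rename w g =
      ∑ m ∈ g.support, coeff m g • alternant N m := by
    conv_lhs => rw [g.as_sum]
    simp only [alternant, map_sum, Finset.smul_sum]
    rw [Finset.sum_comm]
    refine Finset.sum_congr rfl fun m _ => Finset.sum_congr rfl fun w _ => ?_
    rw [monomial_eq, map_mul, Finsupp.prod_fintype _ _ (by simp), ← algebraMap_eq,
      AlgHom.commutes, smul_comm (coeff m g), Algebra.smul_def (coeff m g)]
  rw [h1]
  refine Submodule.sum_mem _ fun m hm => Submodule.smul_mem _ _ (alternant_mem_span _ ?_)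
  rw [← hg (mem_support_iff.1 hm), Finsupp.weight_apply, Finsupp.sum_fintype _ _ (by simp)]
  simp

/-- The product g a_δ is already antisymmetric, so antisymmetrizing it only multiplies it by N!;
hence it is a combination of the a_{μ+δ}, and a_δ cancels. The bound d ≤ N keeps every μ within N
parts, where the bialternant formula applies. -/
theorem exists_sum_schurPoly {N d : ℕ} (hdN : d ≤ N) (g : MvPolynomial (Fin N) ℂ)
    (hs : g.IsSymmetric) (hg : g.IsHomogeneous d) :
    ∃ c : d.Partition → ℂ, g = ∑ μ, c μ • schurPoly N μ := by
  have hG : (g * alternant N (delta N)).IsHomogeneous (d + ∑ i, delta N i) :=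
    hg.mul (alternant_isHomogeneous _)
  have h1 := sum_sign_rename_mem_span _ hG
  have h2 : ∑ w : Perm (Fin N), (Perm.sign w : ℤ) • rename w (g * alternant N (delta N)) =
      (N ! : ℂ) • (g * alternant N (delta N)) := by
    have : ∀ w : Perm (Fin N), (Perm.sign w : ℤ) • rename w (g * alternant N (delta N)) =
        g * alternant N (delta N) := by
      intro w
      rw [map_mul, hs w, rename_alternant]
      rcases Int.units_eq_one_or (Perm.sign w) with h' | h' <;> simp [h']
    rw [Finset.sum_congr rfl fun w _ => this w]
    simp [Fintype.card_perm, Algebra.smul_def]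
  rw [h2] at h1
  have h3 := Submodule.smul_mem _ ((N ! : ℂ)⁻¹) h1
  rw [inv_smul_smul₀ (by exact_mod_cast N.factorial_ne_zero),
    Submodule.mem_span_range_iff_exists_fun] at h3
  obtain ⟨c, hc⟩ := h3
  refine ⟨c, mul_right_cancel₀ (alternant_delta_ne_zero N) ?_⟩
  rw [← hc, Finset.sum_mul]
  refine Finset.sum_congr rfl fun μ _ => ?_
  rw [smul_mul_assoc, mul_comm, alternant_mul_schurPoly μ ((card_parts_le μ).trans hdN)]

/-! ### Symmetric functions of bounded degree are determined in finitely many variables. -/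

theorem coeff_setLastZero {N : ℕ} (f : MvPolynomial (Fin (N + 1)) ℂ) (m : Fin (N + 1) →₀ ℕ)
    (hm : m (Fin.last N) = 0) :
    coeff (Finsupp.equivFunOnFinite.symm fun i : Fin N => m i.castSucc) (setLastZero N f) =
      coeff m f := by
  induction f using MvPolynomial.induction_on' with
  | add p q hp hq => simp [hp, hq]
  | monomial u a =>
    have h1 : setLastZero N (monomial u a) = if u (Fin.last N) = 0 then
        monomial (Finsupp.equivFunOnFinite.symm fun i : Fin N => u i.castSucc) a else 0 := by
      rw [setLastZero, aeval_monomial, Finsupp.prod_fintype _ _ (by simp), Fin.prod_univ_castSucc]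
      by_cases h : u (Fin.last N) = 0
      · rw [if_pos h, monomial_eq, Finsupp.prod_fintype _ _ (by simp)]
        simp [h, algebraMap_eq]
      · simp [h]
    rw [h1]
    split_ifs with h
    · rw [coeff_monomial, coeff_monomial]
      congr 1
      rw [eq_iff_iff]
      constructor
      · intro he
        ext i
        refine Fin.lastCases ?_ (fun j => ?_) i
        · rw [h, hm]
        · have := DFunLike.congr_fun he j
          simpa using this
      · rintro rfl; rfl
    · rw [coeff_zero, coeff_monomial, if_neg]
      rintro rfl
      exact h hm

/-- A monomial of degree at most N misses one of the N + 1 variables. By symmetry that variable may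
be taken to be the last, and such a coefficient survives the specialization. -/
theorem eq_zero_of_setLastZero {N : ℕ} (f : MvPolynomial (Fin (N + 1)) ℂ) (hs : f.IsSymmetric)
    (hd : f.totalDegree ≤ N) (h0 : setLastZero N f = 0) : f = 0 := by
  ext m
  rw [coeff_zero]
  by_contra hm
  obtain ⟨i, hi⟩ : ∃ i, m i = 0 := by
    by_contra! hne
    have h1 := le_totalDegree (mem_support_iff.2 hm)
    rw [Finsupp.sum_fintype _ _ (by simp)] at h1
    have h2 : ∑ _i : Fin (N + 1), 1 ≤ ∑ i, m i :=
      Finset.sum_le_sum fun i _ => Nat.one_le_iff_ne_zero.2 (hne i)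
    simp at h2
    omega
  apply hm
  rw [← hs (Equiv.swap i (Fin.last N))] at hm
  have h1 : coeff (m.mapDomain (Equiv.swap i (Fin.last N))) f = coeff m f := by
    conv_lhs => rw [← hs (Equiv.swap i (Fin.last N))]
    exact coeff_rename_mapDomain _ (Equiv.injective _) _ _
  rw [← h1, ← coeff_setLastZero, h0, coeff_zero]
  have h2 := Finsupp.mapDomain_apply (Equiv.injective (Equiv.swap i (Fin.last N))) m i
  rwa [Equiv.swap_apply_left, hi] at h2

theorem Lambda.ext_of_le {f g : Lambda} (N₀ : ℕ) (h : ∀ N, N₀ ≤ N → f.1 N = g.1 N) : f = g := by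
  have key : ∀ t N, N₀ ≤ N + t → f.1 N = g.1 N := by
    intro t
    induction t with
    | zero => intro N hN; exact h N hN
    | succ t ih =>
      intro N hN
      rw [← f.2.2.1 N, ← g.2.2.1 N, ih (N + 1) (by omega)]
  exact Subtype.ext (funext fun N => key N₀ N (by omega))

theorem Lambda.ext_of_totalDegree_le {f g : Lambda} (d : ℕ) (hf : ∀ N, (f.1 N).totalDegree ≤ d)
    (hg : ∀ N, (g.1 N).totalDegree ≤ d) (h : f.1 d = g.1 d) : f = g := by
  refine Lambda.ext_of_le d fun N hN => ?_
  induction N, hN using Nat.le_induction with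
  | base => exact h
  | succ N hN ih =>
    rw [← sub_eq_zero]
    refine eq_zero_of_setLastZero _ ((f.2.1 _).sub (g.2.1 _))
      ((totalDegree_sub _ _).trans ((max_le (hf _) (hg _)).trans hN)) ?_
    rw [map_sub, f.2.2.1, g.2.2.1, ih, sub_self]

theorem Lambda.coe_sum_smul_apply {ι : Type*} (s : Finset ι) (c : ι → ℂ) (f : ι → Lambda) (N : ℕ) :
    (∑ i ∈ s, c i • f i : Lambda).1 N = ∑ i ∈ s, c i • (f i).1 N := by
  simp [Finset.sum_apply]

/-- A symmetric function that is homogeneous of degree `d` is a combination of Schur functions of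
partitions of `d`. -/
theorem exists_sum_schur {d : ℕ} (q : Lambda) (hq : ∀ N, (q.1 N).IsHomogeneous d) :
    ∃ c : d.Partition → ℂ, q = ∑ μ, c μ • schur μ := by
  obtain ⟨c, hc⟩ := exists_sum_schurPoly le_rfl (q.1 d) (q.2.1 d) (hq d)
  refine ⟨c, Lambda.ext_of_totalDegree_le d (fun N => (hq N).totalDegree_le) (fun N => ?_) ?_⟩
  · rw [Lambda.coe_sum_smul_apply]
    exact totalDegree_finsetSum_le fun μ _ =>
      (totalDegree_smul_le _ _).trans (totalDegree_schurPoly_le N μ)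
  · rw [Lambda.coe_sum_smul_apply]
    exact hc

/-! ### The stable Pieri rule -/

/-- The complete homogeneous symmetric polynomial `h_r(x₁, …, x_N)`. -/
def complete (N r : ℕ) : MvPolynomial (Fin N) ℂ :=
  ∑ l ∈ Finset.finsuppAntidiag Finset.univ r, ∏ i, X i ^ l i

theorem coeff_prod_geom (N r : ℕ) :
    PowerSeries.coeff r (∏ i : Fin N,
      PowerSeries.mk fun s => (X i : MvPolynomial (Fin N) ℂ) ^ s) = complete N r := by
  rw [PowerSeries.coeff_prod]
  simp [complete]

open Classical in
/-- Pieri's rule for alternants. -/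
theorem alternant_mul_complete {N : ℕ} (β : Fin (N + 1) → ℕ)
    (hβ : ∀ j : Fin N, β j.succ < β j.castSucc) (r : ℕ) :
    alternant (N + 1) β * complete (N + 1) r =
      ∑ l ∈ (Finset.finsuppAntidiag Finset.univ r).filter fun l : Fin (N + 1) →₀ ℕ =>
        ∀ j : Fin N, β j.succ + l j.succ < β j.castSucc,
        alternant (N + 1) fun i => β i + l i := by
  -- In a power series variable t, `A` has entries ∑ x_i^{β_j+s} t^s. The matrix `B` truncates every
  -- column but the first to exponents below β of the preceding column, which is the horizontal
  -- strip condition.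
  let ok : Fin (N + 1) → ℕ → Prop := Fin.cons (fun _ => True)
    fun (j : Fin N) s => β j.succ + s < β j.castSucc
  let x : Fin (N + 1) → MvPolynomial (Fin (N + 1)) ℂ := X
  let A : Matrix (Fin (N + 1)) (Fin (N + 1)) (PowerSeries (MvPolynomial (Fin (N + 1)) ℂ)) :=
    Matrix.of fun i j => PowerSeries.mk fun s => x i ^ (β j + s)
  let B : Matrix (Fin (N + 1)) (Fin (N + 1)) (PowerSeries (MvPolynomial (Fin (N + 1)) ℂ)) :=
    Matrix.of fun i j => PowerSeries.mk fun s => if ok j s then x i ^ (β j + s) else 0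
  -- Column operations: the tail cut off from column j+1 is t^{β_j-β_{j+1}} times column j of `A`.
  have hAB : A.det = B.det := by
    refine Matrix.det_eq_of_forall_col_eq_smul_add_pred
      (fun j => PowerSeries.X ^ (β j.castSucc - β j.succ)) (fun i => ?_) (fun i j => ?_)
    · ext1 s
      simp [A, B, ok]
    · ext1 s
      have hj := hβ j
      simp only [A, B, ok, Matrix.of_apply, map_add, PowerSeries.coeff_mk, Fin.cons_succ,
        PowerSeries.coeff_X_pow_mul']
      by_cases h : β j.succ + s < β j.castSucc
      · rw [if_pos h, if_neg (by omega), add_zero]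
      · rw [if_neg h, if_pos (by omega), zero_add]
        congr 1
        omega
  -- Row i of `A` has the common factor 1/(1 - x_i t), and the product of these factors generates
  -- the h_r.
  have hA : A.det = PowerSeries.C (alternant (N + 1) β) * ∏ i, PowerSeries.mk fun s => x i ^ s := by
    have h1 : A = Matrix.of fun i j => (PowerSeries.mk fun s => x i ^ s) *
        ((PowerSeries.C : _ →+* PowerSeries (MvPolynomial (Fin (N + 1)) ℂ)).mapMatrix
          (Matrix.of fun i j => x i ^ β j)) i j := by
      ext i j s : 3
      simp only [A, Matrix.of_apply, PowerSeries.coeff_mk, RingHom.mapMatrix_apply, Matrix.map_apply,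
        PowerSeries.coeff_mul_C, pow_add, mul_comm]
    rw [h1, Matrix.det_mul_column, ← RingHom.map_det, mul_comm, alternant_eq_det]
  have h2 := congrArg (PowerSeries.coeff r) (hA.symm.trans hAB)
  rw [PowerSeries.coeff_C_mul, coeff_prod_geom] at h2
  rw [h2, Matrix.det_apply, map_sum, Finset.sum_filter]
  have h3 : ∀ σ : Perm (Fin (N + 1)), PowerSeries.coeff r (Perm.sign σ • ∏ j, B (σ j) j) =
      ∑ l ∈ Finset.finsuppAntidiag Finset.univ r, if ∀ j : Fin N, β j.succ + l j.succ < β j.castSucc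
        then (Perm.sign σ : ℤ) • rename σ (∏ i, X i ^ (β i + l i)) else 0 := by
    intro σ
    have h4 : PowerSeries.coeff r (∏ j, B (σ j) j) = ∑ l ∈ Finset.finsuppAntidiag Finset.univ r,
        if ∀ j : Fin N, β j.succ + l j.succ < β j.castSucc
        then rename σ (∏ i, X i ^ (β i + l i)) else 0 := by
      rw [PowerSeries.coeff_prod]
      refine Finset.sum_congr rfl fun l _ => ?_
      simp only [B, Matrix.of_apply, PowerSeries.coeff_mk]
      split_ifs with h
      · simp only [map_prod, map_pow, rename_X]
        refine Finset.prod_congr rfl fun i _ => if_pos ?_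
        refine Fin.cases ?_ (fun j => ?_) i
        · simp [ok]
        · simpa [ok] using h j
      · push Not at h
        obtain ⟨j, hj⟩ := h
        exact Finset.prod_eq_zero (Finset.mem_univ j.succ) (if_neg (by simpa [ok] using hj))
    rcases Int.units_eq_one_or (Perm.sign σ) with h' | h'
    · simp only [h', one_smul, h4, Units.val_one]
    · rw [h', Units.neg_smul, one_smul, map_neg, h4, ← Finset.sum_neg_distrib]
      refine Finset.sum_congr rfl fun l _ => ?_
      split_ifs <;> simp
  rw [Finset.sum_congr rfl fun σ _ => h3 σ, Finset.sum_comm]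
  refine Finset.sum_congr rfl fun l _ => ?_
  split_ifs <;> simp [alternant]

/-- The function `s_{μ[n]}`, set to zero when `μ[n]` is not defined. -/
def paddedSchur {j : ℕ} (μ : j.Partition) (n : ℕ) : Lambda :=
  if h : j + row μ 0 ≤ n then schur (padded μ n h) else 0

theorem addDelta_step {N n : ℕ} (μ : n.Partition) (j : Fin N) :
    addDelta (N + 1) μ j.castSucc = row μ j + (N - j) ∧
      addDelta (N + 1) μ j.succ = row μ (j + 1) + (N - j - 1) := by
  constructor <;> simp [addDelta, delta]
  omega

open Classical in
/-- The stable form of Pieri's rule: `h_{n-k} s_λ` is the sum of the `s_{ρ[n]}` over the `ρ` that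
are obtained from `λ` by removing a horizontal strip. -/
theorem complete_mul_schurPoly {k n N : ℕ} (lam : k.Partition) (hn : 2 * k ≤ n) (hN : n ≤ N) :
    complete (N + 1) (n - k) * schurPoly (N + 1) lam =
      ∑ p ∈ (Finset.range (k + 1)).sigma (fun j => (Finset.univ : Finset j.Partition)),
        if ∀ i, row lam (i + 1) ≤ row p.2 i ∧ row p.2 i ≤ row lam i then
          (paddedSchur p.2 n).1 (N + 1) else 0 := by
  refine mul_left_cancel₀ (alternant_delta_ne_zero (N + 1)) ?_
  have hlam : lam.parts.card ≤ N := (card_parts_le lam).trans (by omega)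
  rw [mul_left_comm, alternant_mul_schurPoly lam (by omega), mul_comm,
    alternant_mul_complete _ (fun j => by
      rw [(addDelta_step lam j).1, (addDelta_step lam j).2]
      have := row_antitone lam (Nat.le_succ j)
      have := j.2
      simp only [Nat.succ_eq_add_one] at *
      omega), ← Finset.sum_filter, Finset.mul_sum]
  have hlt : ∀ p ∈ ((Finset.range (k + 1)).sigma
      (fun j => (Finset.univ : Finset j.Partition))).filter
      (fun p => ∀ i, row lam (i + 1) ≤ row p.2 i ∧ row p.2 i ≤ row lam i), p.1 < k + 1 ∧
        ∀ i, row lam (i + 1) ≤ row p.2 i ∧ row p.2 i ≤ row lam i := by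
    rintro ⟨j, μ⟩ hp
    simpa using hp
  symm
  have hrow0 : ∀ i, N ≤ i → row lam i = 0 := fun i hi => (row_eq_zero_iff _ _).2 (hlam.trans hi)
  have hlk : row lam 0 ≤ k := by simpa using sum_row_le lam 1
  -- The exponent increments are the row lengths of the strip ρ[n]/λ. Since |ρ|, λ₁ ≤ k and n ≥ 2k,
  -- the subtraction in the first row is not truncated.
  refine Finset.sum_bij (fun p _ => Finsupp.equivFunOnFinite.symm
    (Fin.cons (n - p.1 - row lam 0) fun i : Fin N => row p.2 i - row lam (i + 1))) ?_ ?_ ?_ ?_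
  · intro p hp
    obtain ⟨h1, h2⟩ := hlt p hp
    have hpN : p.2.parts.card ≤ N := (card_parts_le _).trans (by omega)
    have h3 := sum_row_eq p.2 hpN
    have h4 := sum_row_eq lam (N := N + 1) (by omega)
    rw [Fin.sum_univ_succ] at h4
    have h5 : ∑ i : Fin N, (row p.2 i - row lam (i + 1)) + ∑ i : Fin N, row lam (i + 1) =
        ∑ i : Fin N, row p.2 i := by
      rw [← Finset.sum_add_distrib]
      exact Finset.sum_congr rfl fun i _ => Nat.sub_add_cancel (h2 i).1
    rw [Finset.mem_filter, Finset.mem_finsuppAntidiag]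
    refine ⟨⟨?_, Finset.subset_univ _⟩, fun j => ?_⟩
    · simp only [Finsupp.equivFunOnFinite_symm_apply_apply]
      rw [Fin.sum_univ_succ]
      simp only [Fin.cons_zero, Fin.cons_succ]
      simp only [Fin.val_succ, Fin.val_zero] at h4
      omega
    · rw [(addDelta_step lam j).1, (addDelta_step lam j).2]
      simp only [Finsupp.equivFunOnFinite_symm_apply_apply, Fin.cons_succ]
      have := h2 j
      have := j.2
      omega
  · intro p hp p' hp' he
    obtain ⟨h1, h2⟩ := hlt p hp
    obtain ⟨h1', h2'⟩ := hlt p' hp'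
    refine sigma_eq_of_row_eq p.2 p'.2 fun i => ?_
    by_cases hi : i < N
    · have h3 := DFunLike.congr_fun he (Fin.succ ⟨i, hi⟩)
      simp only [Finsupp.equivFunOnFinite_symm_apply_apply, Fin.cons_succ] at h3
      have := h2 i
      have := h2' i
      omega
    · have := h2 i
      have := h2' i
      have := hrow0 i (by omega)
      omega
  · intro l hl
    rw [Finset.mem_filter, Finset.mem_finsuppAntidiag] at hl
    obtain ⟨⟨h1, -⟩, h2⟩ := hl
    -- The inverse map: λ plus the increments, with the first row removed, gives the rows of ρ.
    let r : ℕ → ℕ := fun i => if h : i < N then row lam (i + 1) + l (Fin.succ ⟨i, h⟩) else 0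
    have hr : ∀ i, row lam (i + 1) ≤ r i ∧ r i ≤ row lam i := by
      intro i
      by_cases hi : i < N
      · have := h2 ⟨i, hi⟩
        rw [(addDelta_step lam _).1, (addDelta_step lam _).2] at this
        simp only [r, hi, dif_pos]
        simp only at this
        omega
      · simp [r, hi, hrow0 (i + 1) (by omega)]
    have hanti : Antitone r := antitone_nat_of_succ_le fun i => (hr (i + 1)).2.trans (hr i).1
    obtain ⟨μ, hμ⟩ := exists_partition_row N r hanti (fun i hi => by simp [r, hi]) rfl
    have hsum : ∑ i : Fin N, r i = ∑ i : Fin N, row lam (i + 1) + ∑ i : Fin N, l i.succ := by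
      rw [← Finset.sum_add_distrib]
      exact Finset.sum_congr rfl fun i _ => by simp only [r, i.2, dif_pos, Fin.eta]
    have hle : ∑ i : Fin N, r i ≤ k :=
      (Finset.sum_le_sum fun (i : Fin N) _ => (hr i).2).trans (sum_row_le lam N)
    have h4 := sum_row_eq lam (N := N + 1) (by omega)
    rw [Fin.sum_univ_succ] at h4 h1
    simp only [Fin.val_succ, Fin.val_zero] at h4
    refine ⟨⟨_, μ⟩, ?_, ?_⟩
    · rw [Finset.mem_filter, Finset.mem_sigma, Finset.mem_range]
      exact ⟨⟨Nat.lt_succ_of_le hle, Finset.mem_univ _⟩, fun i => by simpa only [hμ] using hr i⟩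
    · ext i
      simp only [Finsupp.equivFunOnFinite_symm_apply_apply]
      refine Fin.cases ?_ (fun j => ?_) i
      · simp only [Fin.cons_zero]
        omega
      · simp only [Fin.cons_succ, hμ, r, j.2, dif_pos, Fin.eta]
        omega
  · intro p hp
    obtain ⟨h1, h2⟩ := hlt p hp
    have hp : p.1 + row p.2 0 ≤ n := add_row_zero_le p.2 h1 hn
    rw [paddedSchur, dif_pos hp]
    refine (alternant_mul_schurPoly _ ((card_parts_le _).trans (by omega))).trans ?_
    congr 1
    funext i
    have h3 := row_padded p.2 n hp
    simp only [Finsupp.equivFunOnFinite_symm_apply_apply]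
    refine Fin.cases ?_ (fun j => ?_) i
    · simp only [addDelta, Fin.cons_zero, Fin.val_zero, h3.1]
      omega
    · simp only [addDelta, Fin.cons_succ, Fin.val_succ, h3.2]
      have := (h2 j).1
      omega

/-! ### Power sums as sums over invariant colourings -/

/-- The sum of the monomials of all colourings of `α` by `x₁, …, x_N` that are constant on the
cycles of `w`. -/
def colourSum {α : Type*} [Fintype α] [DecidableEq α] (w : Perm α) (N : ℕ) :
    MvPolynomial (Fin N) ℂ :=
  ∑ c : α → Fin N with c ∘ w = c, ∏ a, X (c a)

/-- The power sum symmetric function of the cycle type of a permutation. -/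
def cyclePowerSum {α : Type*} [Fintype α] [DecidableEq α] (w : Perm α) : Lambda :=
  powerSumPartition w.partition

theorem powerSumPartition_apply {n : ℕ} (μ : n.Partition) (N : ℕ) :
    (powerSumPartition μ).1 N = (μ.parts.map fun d => psum (Fin N) ℂ d).prod := by
  let ev : Lambda →+* MvPolynomial (Fin N) ℂ := (Pi.evalRingHom _ N).comp Lambda.val.toRingHom
  change ev (powerSumPartition μ) = _
  rw [powerSumPartition, map_multiset_prod, Multiset.map_pmap]
  rw [Multiset.pmap_eq_map (p := fun d => 0 < d) (f := fun d => psum (Fin N) ℂ d)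
    (H := fun d hd => μ.parts_pos hd) |>.symm]
  rfl

theorem comp_eq_iff_sameCycle {α β : Type*} (w : Perm α) (c : α → β) :
    c ∘ w = c ↔ ∀ a b, w.SameCycle a b → c a = c b := by
  constructor
  · rintro h a b ⟨i, rfl⟩
    have h1 : ∀ a, c (w a) = c a := fun a => congrFun h a
    induction i using Int.induction_on with
    | zero => simp
    | succ i ih => rw [ih, add_comm, zpow_add, zpow_one, Perm.mul_apply, h1]
    | pred i ih =>
      rw [ih, sub_eq_add_neg, add_comm, zpow_add, Perm.mul_apply, zpow_neg_one, ← h1 (w⁻¹ _),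
        ← Perm.mul_apply w, mul_inv_cancel, Perm.one_apply]
  · intro h
    funext a
    exact (h a (w a) ⟨1, by simp⟩).symm

/-- The parts of the partition of w are the sizes of its orbits. The cycle type omits fixed points,
so the orbits are split into those inside the support and the singletons. -/
theorem prod_quotient_sameCycle {α M : Type*} [Fintype α] [DecidableEq α] [CommMonoid M]
    (w : Perm α) [DecidableEq (Quotient (Perm.SameCycle.setoid w))]
    [Fintype (Quotient (Perm.SameCycle.setoid w))] (f : ℕ → M) :
    ∏ q : Quotient (Perm.SameCycle.setoid w),
      f (Finset.univ.filter fun a => Quotient.mk (Perm.SameCycle.setoid w) a = q).card =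
      (w.partition.parts.map f).prod := by
  have hmk : ∀ a b, Quotient.mk (Perm.SameCycle.setoid w) a = Quotient.mk _ b ↔
      w.SameCycle a b := fun a b => Quotient.eq
  have hout : ∀ a (q : Quotient (Perm.SameCycle.setoid w)), Quotient.mk _ a = q ↔
      w.SameCycle q.out a := fun a q => by
    rw [Perm.sameCycle_comm, ← hmk, Quotient.out_eq]
  rw [Perm.parts_partition, Multiset.map_add, Multiset.prod_add, Perm.cycleType_def,
    Multiset.map_map, ← Finset.prod_filter_mul_prod_filter_not Finset.univ
      (fun q : Quotient (Perm.SameCycle.setoid w) => q.out ∈ w.support)]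
  congr 1
  · refine Finset.prod_bij (fun q _ => w.cycleOf q.out) ?_ ?_ ?_ ?_
    · intro q hq
      exact Perm.cycleOf_mem_cycleFactorsFinset_iff.2 (Finset.mem_filter.1 hq).2
    · intro q hq q' hq' h
      rw [← Perm.sameCycle_iff_cycleOf_eq_of_mem_support (Finset.mem_filter.1 hq).2
        (Finset.mem_filter.1 hq').2, ← hmk, Quotient.out_eq, Quotient.out_eq] at h
      exact h
    · intro g hg
      obtain ⟨a, ha⟩ := (Perm.mem_cycleFactorsFinset_iff.1 hg).1.nonempty_support
      have hw : a ∈ w.support := Perm.mem_cycleFactorsFinset_support_le hg ha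
      have hsc : w.SameCycle (Quotient.mk (Perm.SameCycle.setoid w) a).out a := (hout _ _).1 rfl
      refine ⟨Quotient.mk _ a, ?_, ?_⟩
      · rw [Finset.mem_filter]
        exact ⟨Finset.mem_univ _, hsc.mem_support_iff.2 hw⟩
      · rw [Perm.cycle_is_cycleOf ha hg]
        exact hsc.cycleOf_eq
    · intro q hq
      simp only [Function.comp_apply]
      congr 2
      ext a
      rw [Finset.mem_filter, hout, Perm.mem_support_cycleOf_iff]
      exact ⟨fun h => ⟨h.2, (Finset.mem_filter.1 hq).2⟩, fun h => ⟨Finset.mem_univ _, h.1⟩⟩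
  · have h1 : ∀ q ∈ Finset.univ.filter
        (fun q : Quotient (Perm.SameCycle.setoid w) => ¬ q.out ∈ w.support),
        f (Finset.univ.filter fun a => Quotient.mk (Perm.SameCycle.setoid w) a = q).card = f 1 := by
      intro q hq
      congr 1
      rw [Finset.card_eq_one]
      refine ⟨q.out, ?_⟩
      ext a
      rw [Finset.mem_filter, hout, Finset.mem_singleton]
      refine ⟨fun h => ?_, fun h => ⟨Finset.mem_univ _, h ▸ Perm.SameCycle.refl _ _⟩⟩
      have h2 := Perm.notMem_support.1 (Finset.mem_filter.1 hq).2
      exact (Perm.SameCycle.eq_of_left h.2 h2).symm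
    rw [Finset.prod_congr rfl h1, Finset.prod_const, Multiset.map_replicate, Multiset.prod_replicate]
    congr 1
    rw [← Finset.card_compl]
    refine Finset.card_bij (fun q _ => q.out) ?_ (fun q _ q' _ h => Quotient.out_injective h) ?_
    · intro q hq
      simpa using (Finset.mem_filter.1 hq).2
    · intro a ha
      rw [Finset.mem_compl] at ha
      have h2 : (Quotient.mk (Perm.SameCycle.setoid w) a).out = a :=
        (((hout a _).1 rfl).symm.eq_of_left (Perm.notMem_support.1 ha)).symm
      exact ⟨Quotient.mk _ a, Finset.mem_filter.2 ⟨Finset.mem_univ _, by rwa [h2]⟩, h2⟩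

/-- Expanding the product of the p_d over the cycles chooses one variable for each cycle, that is, a
colouring constant on cycles. -/
theorem cyclePowerSum_apply {α : Type*} [Fintype α] [DecidableEq α] (w : Perm α) (N : ℕ) :
    (cyclePowerSum w).1 N = colourSum w N := by
  classical
  rw [cyclePowerSum, powerSumPartition_apply, ← prod_quotient_sameCycle]
  simp only [psum]
  rw [Finset.prod_univ_sum, colourSum, Fintype.piFinset_univ]
  refine Finset.sum_bij (fun x _ a => x (Quotient.mk _ a)) ?_ ?_ ?_ ?_
  · intro x _
    rw [Finset.mem_filter, comp_eq_iff_sameCycle]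
    exact ⟨Finset.mem_univ _, fun a b h => congrArg x (Quotient.sound h)⟩
  · intro x _ y _ h
    funext q
    induction q using Quotient.inductionOn with
    | h a => exact congrFun h a
  · intro c hc
    rw [Finset.mem_filter, comp_eq_iff_sameCycle] at hc
    exact ⟨Quotient.lift c hc.2, Finset.mem_univ _, rfl⟩
  · intro x _
    rw [← Finset.prod_fiberwise (s := (Finset.univ : Finset α))
      (g := fun a => Quotient.mk (Perm.SameCycle.setoid w) a)]
    refine Finset.prod_congr rfl fun q _ => ?_
    rw [Finset.prod_congr rfl (g := fun _ => X (x q)) fun a ha => by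
      exact congrArg (fun q => X (x q)) (Finset.mem_filter.1 ha).2, Finset.prod_const]

theorem colourSum_isHomogeneous {α : Type*} [Fintype α] [DecidableEq α] (w : Perm α) (N : ℕ) :
    (colourSum w N).IsHomogeneous (Fintype.card α) := by
  refine IsHomogeneous.sum _ _ _ fun c _ => ?_
  have := IsHomogeneous.prod (Finset.univ : Finset α) (fun a => (X (c a) : MvPolynomial (Fin N) ℂ))
    (fun _ => 1) fun a _ => isHomogeneous_X ℂ _
  simpa using this

theorem colourSum_permCongr {α β : Type*} [Fintype α] [DecidableEq α] [Fintype β] [DecidableEq β]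
    (e : α ≃ β) (w : Perm α) (N : ℕ) : colourSum (e.permCongr w) N = colourSum w N := by
  refine Finset.sum_bij (fun c _ => c ∘ e) ?_ ?_ ?_ ?_
  · intro c hc
    have h := (Finset.mem_filter.1 hc).2
    refine Finset.mem_filter.2 ⟨Finset.mem_univ _, funext fun a => ?_⟩
    simpa using congrFun h (e a)
  · intro c _ c' _ h
    exact e.surjective.injective_comp_right h
  · intro c hc
    have h := (Finset.mem_filter.1 hc).2
    refine ⟨c ∘ e.symm, Finset.mem_filter.2 ⟨Finset.mem_univ _, funext fun b => ?_⟩, ?_⟩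
    · simpa using congrFun h (e.symm b)
    · funext a; simp
  · intro c _
    exact (Equiv.prod_comp e fun b => (X (c b) : MvPolynomial (Fin N) ℂ)).symm

theorem colourSum_subtypeCongr {α : Type*} [Fintype α] [DecidableEq α] (p : α → Prop)
    [DecidablePred p] (ep : Perm {a // p a}) (en : Perm {a // ¬ p a}) (N : ℕ) :
    colourSum (Perm.subtypeCongr ep en) N = colourSum ep N * colourSum en N := by
  rw [colourSum, colourSum, colourSum, Finset.sum_mul_sum, ← Finset.sum_product']
  refine Finset.sum_bij (fun c _ => (fun a => c a, fun a => c a)) ?_ ?_ ?_ ?_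
  · intro c hc
    have h := (Finset.mem_filter.1 hc).2
    rw [Finset.mem_product, Finset.mem_filter, Finset.mem_filter]
    refine ⟨⟨Finset.mem_univ _, funext fun a => ?_⟩, ⟨Finset.mem_univ _, funext fun a => ?_⟩⟩
    · simpa using congrFun h a
    · simpa using congrFun h a
  · intro c _ c' _ h
    funext a
    by_cases ha : p a
    · exact congrFun (congrArg Prod.fst h) ⟨a, ha⟩
    · exact congrFun (congrArg Prod.snd h) ⟨a, ha⟩
  · rintro ⟨c, c'⟩ hc
    rw [Finset.mem_product, Finset.mem_filter, Finset.mem_filter] at hc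
    refine ⟨(Equiv.piEquivPiSubtypeProd p fun _ => Fin N).symm (c, c'), ?_,
      (Equiv.piEquivPiSubtypeProd p fun _ => Fin N).apply_symm_apply (c, c')⟩
    rw [Finset.mem_filter]
    refine ⟨Finset.mem_univ _, funext fun a => ?_⟩
    by_cases ha : p a
    · have := congrFun hc.1.2 ⟨a, ha⟩
      simpa [Perm.subtypeCongr.left_apply _ _ ha, ha, (ep ⟨a, ha⟩).2] using this
    · have := congrFun hc.2.2 ⟨a, ha⟩
      simpa [Perm.subtypeCongr.right_apply _ _ ha, ha, (en ⟨a, ha⟩).2] using this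
  · intro c _
    exact (Fintype.prod_subtype_mul_prod_subtype p fun a =>
      (X (c a) : MvPolynomial (Fin N) ℂ)).symm

theorem exists_perm_comp_eq {α β : Type*} [Fintype α] [DecidableEq β]
    (c c' : α → β) (h : ∀ i, (Finset.univ.filter fun a => c a = i).card =
      (Finset.univ.filter fun a => c' a = i).card) : ∃ u : Perm α, c' ∘ u = c := by
  have e : ∀ i, {a // c a = i} ≃ {a // c' a = i} := fun i =>
    Fintype.equivOfCardEq (by rw [Fintype.card_subtype, Fintype.card_subtype, h])
  exact ⟨Equiv.ofFiberEquiv e, funext fun a => Equiv.ofFiberEquiv_map e a⟩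

theorem exists_colouring {α β : Type*} [Fintype α] [Fintype β] [DecidableEq β] (l : β → ℕ)
    (h : ∑ i, l i = Fintype.card α) :
    ∃ c : α → β, ∀ i, (Finset.univ.filter fun a => c a = i).card = l i := by
  have e : α ≃ Σ i, Fin (l i) := Fintype.equivOfCardEq (by simp [h])
  refine ⟨fun a => (e a).1, fun i => ?_⟩
  rw [← Fintype.card_subtype]
  have e' : {a // (e a).1 = i} ≃ Fin (l i) :=
    (e.subtypeEquiv fun a => Iff.rfl : _ ≃ {x : Σ i, Fin (l i) // x.1 = i}).trans
      (Equiv.sigmaSubtype i)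
  rw [Fintype.card_congr e', Fintype.card_fin]

/-- Exchanging the sums counts each colouring with the order of its stabilizer. The colourings with
given colour multiplicities form one orbit of the symmetric group, so by orbit-stabilizer every
monomial of degree |α| gets the coefficient |α|!. -/
theorem sum_colourSum {α : Type*} [Fintype α] [DecidableEq α] (N : ℕ) :
    ∑ w : Perm α, colourSum w N = ((Fintype.card α)! : ℂ) • complete N (Fintype.card α) := by
  let cnt : (α → Fin N) → Fin N →₀ ℕ := fun c =>
    Finsupp.equivFunOnFinite.symm fun i => (Finset.univ.filter fun a => c a = i).card
  have hcnt : ∀ c i, cnt c i = (Finset.univ.filter fun a => c a = i).card := fun c i => rfl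
  have hmaps : ∀ c ∈ (Finset.univ : Finset (α → Fin N)),
      cnt c ∈ Finset.finsuppAntidiag Finset.univ (Fintype.card α) := by
    intro c _
    rw [Finset.mem_finsuppAntidiag]
    refine ⟨?_, Finset.subset_univ _⟩
    simp only [hcnt]
    rw [← Finset.card_univ]
    exact (Finset.card_eq_sum_card_fiberwise fun a _ => Finset.mem_univ (c a)).symm
  have h1 : ∑ w : Perm α, colourSum w N = ∑ c : α → Fin N,
      ((Finset.univ.filter fun w : Perm α => c ∘ w = c).card : ℂ) • ∏ i, X i ^ cnt c i := by
    simp only [colourSum, Finset.sum_filter]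
    rw [Finset.sum_comm]
    refine Finset.sum_congr rfl fun c _ => ?_
    rw [← Finset.sum_filter, Finset.sum_const, Nat.cast_smul_eq_nsmul]
    congr 1
    rw [Finset.prod_comp (fun i => (X i : MvPolynomial (Fin N) ℂ)) c]
    refine Finset.prod_subset (Finset.subset_univ _) fun i _ hi => ?_
    rw [Finset.card_eq_zero.2, pow_zero]
    rw [Finset.filter_eq_empty_iff]
    rintro a _ rfl
    exact hi (Finset.mem_image_of_mem _ (Finset.mem_univ _))
  rw [h1, ← Finset.sum_fiberwise_of_maps_to hmaps, complete, Finset.smul_sum]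
  refine Finset.sum_congr rfl fun l hl => ?_
  rw [Finset.mem_finsuppAntidiag] at hl
  obtain ⟨c₀, hc₀⟩ := exists_colouring (α := α) l hl.1
  rw [Finset.sum_congr rfl (g := fun c => ((Finset.univ.filter
    fun u : Perm α => c₀ ∘ u = c).card : ℂ) • ∏ i, (X i : MvPolynomial (Fin N) ℂ) ^ l i) ?_,
    ← Finset.sum_smul, ← Nat.cast_sum]
  · congr 2
    rw [← Fintype.card_perm, ← Finset.card_univ]
    refine (Finset.card_eq_sum_card_fiberwise fun u _ => ?_).symm
    rw [Finset.mem_coe, Finset.mem_filter]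
    refine ⟨Finset.mem_univ _, Finsupp.ext fun i => ?_⟩
    rw [hcnt, ← hc₀ i]
    exact Finset.card_bij (fun a _ => u a) (by simp) (fun _ _ _ _ h => u.injective h)
      fun b hb => ⟨u⁻¹ b, by simpa using hb, by simp⟩
  · intro c hc
    have hcl : cnt c = l := (Finset.mem_filter.1 hc).2
    rw [hcl]
    congr 2
    -- Left translation by u identifies the stabilizer of `c` with the permutations carrying `c₀` to
    -- `c`; these sets partition the whole group as `c` varies.
    obtain ⟨u, hu⟩ := exists_perm_comp_eq c c₀ fun i => by rw [hc₀, ← hcl, hcnt]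
    refine Finset.card_bij (fun w _ => u * w) ?_ (fun _ _ _ _ h => mul_left_cancel h) ?_
    · intro w hw
      have := (Finset.mem_filter.1 hw).2
      refine Finset.mem_filter.2 ⟨Finset.mem_univ _, ?_⟩
      rw [Perm.coe_mul, ← Function.comp_assoc, hu, this]
    · intro v hv
      have := (Finset.mem_filter.1 hv).2
      refine ⟨u⁻¹ * v, Finset.mem_filter.2 ⟨Finset.mem_univ _, ?_⟩, by simp⟩
      conv_lhs => rw [← hu]
      rw [Function.comp_assoc, ← Perm.coe_mul, mul_inv_cancel_left, this]

/-! ### Sequences with a stable Schur expansion -/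

/-- `F n = ∑_{|μ| ≤ k} c_μ(n) s_{μ[n]}` for `n ≥ M, 2k`, with polynomials `c_μ` of degree at most
`k - |μ|`. -/
def StablyExpands (k M : ℕ) (F : ℕ → Lambda) : Prop :=
  ∃ c : (j : ℕ) → j.Partition → Polynomial ℂ,
    (∀ (j : ℕ) (μ : j.Partition), j ≤ k → (c j μ).natDegree ≤ k - j) ∧
    ∀ n, M ≤ n → 2 * k ≤ n → F n = ∑ j ∈ Finset.range (k + 1), ∑ μ : j.Partition,
      (c j μ).eval (n : ℂ) • paddedSchur μ n

theorem StablyExpands.add {k M : ℕ} {F G : ℕ → Lambda} (hF : StablyExpands k M F)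
    (hG : StablyExpands k M G) : StablyExpands k M fun n => F n + G n := by
  obtain ⟨c, hc, hc'⟩ := hF
  obtain ⟨d, hd, hd'⟩ := hG
  refine ⟨fun j μ => c j μ + d j μ, fun j μ hj =>
    (Polynomial.natDegree_add_le _ _).trans (max_le (hc j μ hj) (hd j μ hj)), fun n hM hn => ?_⟩
  simp only [hc' n hM hn, hd' n hM hn, Polynomial.eval_add, add_smul, Finset.sum_add_distrib]

theorem StablyExpands.smul {k M : ℕ} {F : ℕ → Lambda} (hF : StablyExpands k M F) (a : ℂ) :
    StablyExpands k M fun n => a • F n := by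
  obtain ⟨c, hc, hc'⟩ := hF
  refine ⟨fun j μ => Polynomial.C a * c j μ, fun j μ hj =>
    (Polynomial.natDegree_C_mul_le _ _).trans (hc j μ hj), fun n hM hn => ?_⟩
  simp only [hc' n hM hn, Polynomial.eval_mul, Polynomial.eval_C, mul_smul, Finset.smul_sum]

theorem StablyExpands.sum {k M : ℕ} {ι : Type*} (s : Finset ι) (F : ι → ℕ → Lambda)
    (hF : ∀ i ∈ s, StablyExpands k M (F i)) : StablyExpands k M fun n => ∑ i ∈ s, F i n := by
  classical
  induction s using Finset.induction_on with
  | empty => exact ⟨fun _ _ => 0, by simp, by simp⟩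
  | insert a s ha ih =>
    simp only [Finset.sum_insert ha]
    exact (hF a (Finset.mem_insert_self _ _)).add
      (ih fun i hi => hF i (Finset.mem_insert_of_mem hi))

theorem StablyExpands.eval_smul {k M : ℕ} {F : ℕ → Lambda} (hF : StablyExpands k M F)
    (p : Polynomial ℂ) (hp : p.natDegree ≤ 1) :
    StablyExpands (k + 1) M fun n => p.eval (n : ℂ) • F n := by
  obtain ⟨c, hc, hc'⟩ := hF
  -- Nothing is known about `c j μ` for j > k, so the new coefficients of size k + 1 are set to
  -- zero.
  refine ⟨fun j μ => if j ≤ k then p * c j μ else 0, fun j μ _ => ?_, fun n hM hn => ?_⟩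
  · beta_reduce
    split_ifs with h
    · have := hc j μ h
      exact Polynomial.natDegree_mul_le.trans (by omega)
    · simp
  · beta_reduce
    rw [hc' n hM (by omega), Finset.sum_range_succ _ (k + 1), Finset.smul_sum]
    simp only [Finset.smul_sum]
    rw [Finset.sum_eq_zero (s := (Finset.univ : Finset (k + 1).Partition)) (by simp), add_zero]
    refine Finset.sum_congr rfl fun j hj => Finset.sum_congr rfl fun μ _ => ?_
    rw [if_pos (by simpa [Nat.lt_succ_iff] using hj), Polynomial.eval_mul, mul_smul]

open Classical in
/-- The sum of the `s_{ρ[n]}` over the `ρ` obtained from `λ` by removing a horizontal strip. -/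
def stripSum {k : ℕ} (lam : k.Partition) (n : ℕ) : Lambda :=
  ∑ p ∈ (Finset.range (k + 1)).sigma (fun j => (Finset.univ : Finset j.Partition)),
    if ∀ i, row lam (i + 1) ≤ row p.2 i ∧ row p.2 i ≤ row lam i then paddedSchur p.2 n else 0

theorem stablyExpands_stripSum {k : ℕ} (lam : k.Partition) (M : ℕ) :
    StablyExpands k M (stripSum lam) := by
  classical
  refine ⟨fun j μ => Polynomial.C
    (if ∀ i, row lam (i + 1) ≤ row μ i ∧ row μ i ≤ row lam i then 1 else 0),
    fun j μ _ => by rw [Polynomial.natDegree_C]; exact Nat.zero_le _, fun n _ _ => ?_⟩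
  rw [stripSum, Finset.sum_sigma]
  refine Finset.sum_congr rfl fun j _ => Finset.sum_congr rfl fun μ _ => ?_
  rw [Polynomial.eval_C]
  split_ifs <;> simp

/-- The specialization of symmetric functions to `N` variables. -/
def Lambda.eval (N : ℕ) : Lambda →ₐ[ℂ] MvPolynomial (Fin N) ℂ :=
  (Pi.evalAlgHom ℂ _ N).comp Lambda.val

theorem Lambda.eval_apply (N : ℕ) (f : Lambda) : Lambda.eval N f = f.1 N := rfl

theorem stripSum_apply {k n N : ℕ} (lam : k.Partition) (hn : 2 * k ≤ n) (hN : n ≤ N) :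
    Lambda.eval (N + 1) (stripSum lam n) =
      complete (N + 1) (n - k) * Lambda.eval (N + 1) (schur lam) := by
  classical
  refine Eq.trans ?_ (complete_mul_schurPoly lam hn hN).symm
  rw [stripSum, map_sum]
  refine Finset.sum_congr rfl fun p _ => ?_
  rw [apply_ite (Lambda.eval (N + 1)), map_zero]
  rfl

/-! ### Sums over the extensions of a partial bijection -/

/-- `E` is the graph of a bijection between two finite sets of natural numbers. -/
def IsPartialBij (E : Finset (ℕ × ℕ)) : Prop :=
  Set.InjOn Prod.fst (E : Set (ℕ × ℕ)) ∧ Set.InjOn Prod.snd (E : Set (ℕ × ℕ))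

/-- The permutation `w` of `[n]` extends the partial function with graph `E`. -/
def Extends {n : ℕ} (E : Finset (ℕ × ℕ)) (w : SymGroup n) : Prop :=
  ∀ a b : Finset.Icc 1 n, ((a : ℕ), (b : ℕ)) ∈ E → w a = b

open Classical in
/-- The sum of the power sums `p_{cyc(w)}` over the permutations `w` of `[n]` that extend `E`. -/
def extensionSum (n : ℕ) (E : Finset (ℕ × ℕ)) : Lambda :=
  ∑ w : SymGroup n with Extends E w, cyclePowerSum w

theorem cyclePowerSum_conj {α : Type*} [Fintype α] [DecidableEq α] (w v : Perm α) :
    cyclePowerSum (v * w * v⁻¹) = cyclePowerSum w := by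
  rw [cyclePowerSum, cyclePowerSum]
  congr 1
  exact (Perm.partition_eq_of_isConj.1 (isConj_iff.2 ⟨v, rfl⟩)).symm

theorem extends_insert_swap {n x : ℕ} {E : Finset (ℕ × ℕ)} {y z : Finset.Icc 1 n} {w : SymGroup n}
    (hE : ∀ e ∈ E, e.1 ≠ y ∧ e.1 ≠ z ∧ e.2 ≠ y ∧ e.2 ≠ z) (hxy : x ≠ y) (hxz : x ≠ z)
    (hw : Extends (insert (x, (y : ℕ)) E) w) :
    Extends (insert (x, (z : ℕ)) E) (swap y z * w * (swap y z)⁻¹) := by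
  intro a b hab
  have hne : ∀ (a : Finset.Icc 1 n) (t : ℕ), (a : ℕ) = t → t ≠ y → t ≠ z → swap y z a = a := by
    rintro a t rfl h1 h2
    exact swap_apply_of_ne_of_ne (fun h => h1 (h ▸ rfl)) (fun h => h2 (h ▸ rfl))
  rw [swap_inv, Perm.mul_apply, Perm.mul_apply]
  rcases Finset.mem_insert.1 hab with h | h
  · rw [Prod.mk.injEq] at h
    rw [hne a x h.1 hxy hxz, hw a y (by rw [h.1]; exact Finset.mem_insert_self _ _),
      swap_apply_left]
    exact Subtype.ext h.2.symm
  · obtain ⟨h1, h2, h3, h4⟩ := hE _ h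
    rw [hne a _ rfl h1 h2, hw a b (Finset.mem_insert_of_mem h), hne b _ rfl h3 h4]

/-- Conjugation by the transposition of y and z fixes x and all points of `E`, exchanges the two
sets of extensions and preserves cycle types. -/
theorem extensionSum_insert_eq {n x : ℕ} {E : Finset (ℕ × ℕ)} {y z : ℕ} (hy : y ∈ Finset.Icc 1 n)
    (hz : z ∈ Finset.Icc 1 n) (hE : ∀ e ∈ E, e.1 ≠ y ∧ e.1 ≠ z ∧ e.2 ≠ y ∧ e.2 ≠ z) (hxy : x ≠ y)
    (hxz : x ≠ z) :
    extensionSum n (insert (x, y) E) = extensionSum n (insert (x, z) E) := by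
  classical
  let y' : Finset.Icc 1 n := ⟨y, hy⟩
  let z' : Finset.Icc 1 n := ⟨z, hz⟩
  refine Finset.sum_bij (fun w _ => swap y' z' * w * (swap y' z')⁻¹) ?_ ?_ ?_ ?_
  · intro w hw
    exact Finset.mem_filter.2 ⟨Finset.mem_univ _,
      extends_insert_swap (y := y') (z := z') hE hxy hxz (Finset.mem_filter.1 hw).2⟩
  · intro w _ w' _ h
    exact mul_left_cancel (mul_right_cancel h)
  · intro w hw
    refine ⟨swap y' z' * w * (swap y' z')⁻¹, Finset.mem_filter.2 ⟨Finset.mem_univ _, ?_⟩, ?_⟩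
    · have := extends_insert_swap (y := z') (z := y')
        (fun e he => ⟨(hE e he).2.1, (hE e he).1, (hE e he).2.2.2, (hE e he).2.2.1⟩) hxz hxy
        (Finset.mem_filter.1 hw).2
      rwa [swap_comm] at this
    · simp [mul_assoc, ← mul_assoc (swap y' z') (swap y' z')]
  · intro w _
    exact (cyclePowerSum_conj _ _).symm

theorem extensionSum_eq_sum_insert {n x : ℕ} (hx : x ∈ Finset.Icc 1 n) (E : Finset (ℕ × ℕ)) :
    extensionSum n E = ∑ z ∈ Finset.Icc 1 n, extensionSum n (insert (x, z) E) := by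
  classical
  rw [← Finset.sum_coe_sort, extensionSum,
    ← Finset.sum_fiberwise (g := fun w : SymGroup n => w ⟨x, hx⟩)]
  refine Finset.sum_congr rfl fun z _ => ?_
  rw [extensionSum, Finset.filter_filter]
  refine Finset.sum_congr (Finset.filter_congr fun w _ => ⟨?_, fun h => ⟨?_, ?_⟩⟩) fun _ _ => rfl
  · rintro ⟨h1, rfl⟩ a b hab
    rcases Finset.mem_insert.1 hab with h | h
    · rw [Prod.mk.injEq] at h
      rw [show a = ⟨x, hx⟩ from Subtype.ext h.1]
      exact Subtype.ext h.2.symm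
    · exact h1 a b h
  · exact fun a b hab => h a b (Finset.mem_insert_of_mem hab)
  · exact h _ _ (Finset.mem_insert_self _ _)

theorem extensionSum_insert_eq_zero {n x z x' : ℕ} (hx : x ∈ Finset.Icc 1 n)
    (hx' : x' ∈ Finset.Icc 1 n) (hz : z ∈ Finset.Icc 1 n) (hne : x ≠ x') {E : Finset (ℕ × ℕ)}
    (hE : (x', z) ∈ E) : extensionSum n (insert (x, z) E) = 0 := by
  classical
  refine Finset.sum_eq_zero fun w hw => ?_
  have h := (Finset.mem_filter.1 hw).2
  have h1 := h ⟨x, hx⟩ ⟨z, hz⟩ (Finset.mem_insert_self _ _)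
  have h2 := h ⟨x', hx'⟩ ⟨z, hz⟩ (Finset.mem_insert_of_mem hE)
  exact absurd (congrArg Subtype.val (w.injective (h1.trans h2.symm))) hne

/-- Removing the constraint `x ↦ y`, where `y` is the end of a path of `E`, and distinguishing
the possible images of `x`. -/
theorem extensionSum_erase {n x y : ℕ} {E : Finset (ℕ × ℕ)} (hE : IsPartialBij E)
    (hEn : ∀ e ∈ E, e.1 ∈ Finset.Icc 1 n ∧ e.2 ∈ Finset.Icc 1 n) (hxy : (x, y) ∈ E)
    (hy : y ∉ E.image Prod.fst) :
    extensionSum n (E.erase (x, y)) =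
      (n - (E.image Prod.fst ∪ (E.erase (x, y)).image Prod.snd).card) • extensionSum n E +
      ∑ z ∈ E.image Prod.fst \ E.image Prod.snd,
        extensionSum n (insert (x, z) (E.erase (x, y))) := by
  classical
  set E' := E.erase (x, y) with hE'
  set I := E.image Prod.fst with hI
  set J' := E'.image Prod.snd with hJ'
  have hins : insert (x, y) E' = E := Finset.insert_erase hxy
  have hx : x ∈ I := Finset.mem_image_of_mem Prod.fst hxy
  have hsub : ∀ e ∈ E', e ∈ E := fun e he => Finset.mem_of_mem_erase he
  have hJ : E.image Prod.snd = insert y J' := by rw [← hins, Finset.image_insert]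
  have hyJ : y ∉ J' := by
    intro h
    obtain ⟨e, he, rfl⟩ := Finset.mem_image.1 h
    exact (Finset.mem_erase.1 he).1 (hE.2 (hsub e he) hxy rfl)
  have hIn : I ⊆ Finset.Icc 1 n := by
    intro a ha
    obtain ⟨e, he, rfl⟩ := Finset.mem_image.1 ha
    exact (hEn e he).1
  have hJn : J' ⊆ Finset.Icc 1 n := by
    intro a ha
    obtain ⟨e, he, rfl⟩ := Finset.mem_image.1 ha
    exact (hEn e (hsub e he)).2
  -- A z in `J'` contradicts injectivity, and a z outside `I ∪ J'`, including y itself, can be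
  -- conjugated to y. What remains is the set of z in `I` that are not in the image of `E`.
  have hg : ∀ z ∈ Finset.Icc 1 n, extensionSum n (insert (x, z) E') =
      (if z ∈ I \ insert y J' then extensionSum n (insert (x, z) E') else 0) +
      if z ∉ I ∪ J' then extensionSum n E else 0 := by
    intro z hz
    by_cases h1 : z ∈ J'
    · rw [if_neg (by simp [h1]), if_neg (by simp [h1])]
      obtain ⟨e, he, rfl⟩ := Finset.mem_image.1 h1
      rw [extensionSum_insert_eq_zero (x' := e.1) (hEn _ hxy).1 (hEn e (hsub e he)).1 hz ?_ he,
        add_zero]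
      rintro rfl
      exact (Finset.mem_erase.1 he).1 (hE.1 (hsub e he) hxy rfl)
    · by_cases h2 : z ∈ I
      · have h3 : z ≠ y := fun h => hy (h ▸ h2)
        rw [if_pos (by simp [h1, h2, h3]), if_neg (by simp [h2]), add_zero]
      · rw [if_neg (by simp [h2]), if_pos (by simp [h1, h2]), zero_add, ← hins]
        refine (extensionSum_insert_eq (hEn _ hxy).2 hz (fun e he => ⟨?_, ?_, ?_, ?_⟩) ?_ ?_).symm
        · rintro rfl; exact hy (Finset.mem_image_of_mem Prod.fst (hsub e he))
        · rintro rfl; exact h2 (Finset.mem_image_of_mem Prod.fst (hsub e he))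
        · rintro rfl; exact hyJ (Finset.mem_image_of_mem Prod.snd he)
        · rintro rfl; exact h1 (Finset.mem_image_of_mem Prod.snd he)
        · rintro rfl; exact hy hx
        · rintro rfl; exact h2 hx
  rw [extensionSum_eq_sum_insert (hEn _ hxy).1, Finset.sum_congr rfl hg, Finset.sum_add_distrib,
    add_comm, ← Finset.sum_filter, ← Finset.sum_filter, Finset.sum_const, hJ]
  congr 2
  · rw [Finset.filter_notMem_eq_sdiff, Finset.card_sdiff_of_subset (Finset.union_subset hIn hJn),
      Nat.card_Icc]
    simp
  · ext z
    simp only [Finset.mem_filter, and_iff_right_iff_imp]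
    exact fun h => hIn (Finset.mem_sdiff.1 h).1

theorem exists_perm_of_image_subset {E : Finset (ℕ × ℕ)} (hE : IsPartialBij E)
    (h : E.image Prod.snd ⊆ E.image Prod.fst) :
    ∃ σ : Perm {x // x ∈ E.image Prod.fst},
      ∀ a : {x // x ∈ E.image Prod.fst}, ((a : ℕ), (σ a : ℕ)) ∈ E := by
  have h1 : ∀ a : {x // x ∈ E.image Prod.fst}, ∃ b : {x // x ∈ E.image Prod.fst},
      ((a : ℕ), (b : ℕ)) ∈ E := by
    rintro ⟨a, ha⟩
    obtain ⟨e, he, rfl⟩ := Finset.mem_image.1 ha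
    exact ⟨⟨e.2, h (Finset.mem_image_of_mem Prod.snd he)⟩, he⟩
  choose f hf using h1
  have hinj : Function.Injective f := by
    intro a b hab
    have h2 := hE.2 (hf a) (hf b) (by simp [hab])
    exact Subtype.ext (congrArg Prod.fst h2)
  exact ⟨Equiv.ofBijective f (Finite.injective_iff_bijective.1 hinj), hf⟩

/-- If `E` is the graph of a permutation of a finite set, then the sum over the extensions of `E`
is the product of a fixed symmetric function with a complete homogeneous one. -/
theorem extensionSum_of_perm {n : ℕ} {E : Finset (ℕ × ℕ)}
    (hEn : ∀ e ∈ E, e.1 ∈ Finset.Icc 1 n) (σ : Perm {x // x ∈ E.image Prod.fst})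
    (hσ : ∀ a : {x // x ∈ E.image Prod.fst}, ((a : ℕ), (σ a : ℕ)) ∈ E)
    (hE : IsPartialBij E) (N : ℕ) :
    Lambda.eval N (extensionSum n E) =
      ((n - E.card)! : ℂ) • (Lambda.eval N (cyclePowerSum σ) * complete N (n - E.card)) := by
  classical
  let p : Finset.Icc 1 n → Prop := fun a => (a : ℕ) ∈ E.image Prod.fst
  have hI : ∀ a ∈ E.image Prod.fst, a ∈ Finset.Icc 1 n := by
    intro a ha
    obtain ⟨e, he, rfl⟩ := Finset.mem_image.1 ha
    exact hEn e he
  let ι : {x // x ∈ E.image Prod.fst} ≃ {a // p a} :=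
    { toFun := fun x => ⟨⟨x.1, hI _ x.2⟩, x.2⟩
      invFun := fun a => ⟨a.1.1, a.2⟩
      left_inv := fun _ => rfl
      right_inv := fun _ => rfl }
  let ep : Perm {a // p a} := ι.permCongr σ
  have hep : ∀ a, ((a.1 : ℕ), ((ep a).1 : ℕ)) ∈ E := fun a => hσ (ι.symm a)
  -- An extension agrees with σ on the domain of `E`, hence preserves that domain and its
  -- complement; its restriction to the complement is arbitrary.
  have hsum : extensionSum n E =
      ∑ en : Perm {a // ¬ p a}, cyclePowerSum (Perm.subtypeCongr ep en) := by
    symm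
    refine Finset.sum_bij (fun en _ => Perm.subtypeCongr ep en) ?_ ?_ ?_ fun _ _ => rfl
    · intro en _
      refine Finset.mem_filter.2 ⟨Finset.mem_univ _, fun a b hab => ?_⟩
      have ha : p a := Finset.mem_image_of_mem Prod.fst hab
      rw [Perm.subtypeCongr.left_apply _ _ ha]
      have := hE.1 (hep ⟨a, ha⟩) hab rfl
      exact Subtype.ext (congrArg Prod.snd this)
    · intro en _ en' _ h
      ext a : 2
      have := DFunLike.congr_fun h (a : Finset.Icc 1 n)
      rwa [Perm.subtypeCongr.right_apply_subtype, Perm.subtypeCongr.right_apply_subtype] at this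
    · intro w hw
      have hw' := (Finset.mem_filter.1 hw).2
      have h1 : ∀ a (ha : p a), w a = ep ⟨a, ha⟩ := fun a ha => hw' a _ (hep ⟨a, ha⟩)
      have h2 : ∀ a, p a → p (w a) := fun a ha => by rw [h1 a ha]; exact (ep ⟨a, ha⟩).2
      have h3 : ∀ a, p (w a) → p a := by
        intro a ha
        obtain ⟨b, hb⟩ := ep.surjective ⟨w a, ha⟩
        have h4 : w b = w a := by rw [h1 b b.2, Subtype.coe_eta, hb]
        rw [← w.injective h4]
        exact b.2
      refine ⟨w.subtypePerm fun a => not_congr ⟨h3 a, h2 a⟩, Finset.mem_univ _, ?_⟩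
      ext a : 1
      by_cases ha : p a
      · rw [Perm.subtypeCongr.left_apply _ _ ha, h1 a ha]
      · rw [Perm.subtypeCongr.right_apply _ _ ha]
        rfl
  have hcard : Fintype.card {a // ¬ p a} = n - E.card := by
    rw [Fintype.card_subtype_compl, ← Fintype.card_congr ι, Fintype.card_coe, Fintype.card_coe,
      Nat.card_Icc, Finset.card_image_of_injOn hE.1]
    rfl
  have hcs : ∀ {α : Type} [Fintype α] [DecidableEq α] (w : Perm α),
      Lambda.eval N (cyclePowerSum w) = colourSum w N := fun w => cyclePowerSum_apply w N
  rw [hsum, map_sum]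
  simp only [hcs, colourSum_subtypeCongr]
  rw [← Finset.mul_sum, sum_colourSum, hcard, mul_smul_comm, colourSum_permCongr]

/-- The case of cycles only: the Schur coefficients of the power sum of σ do not involve n, and
Pieri's rule supplies all the dependence on n. -/
theorem exists_stablyExpands_of_perm {M : ℕ} {E : Finset (ℕ × ℕ)} (hE : IsPartialBij E)
    (hEM : ∀ e ∈ E, e.1 ∈ Finset.Icc 1 M) (h : E.image Prod.snd ⊆ E.image Prod.fst) :
    ∃ T, StablyExpands E.card M T ∧ ∀ n, M ≤ n → 2 * E.card ≤ n →
      extensionSum n E = ((n - E.card)! : ℂ) • T n := by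
  obtain ⟨σ, hσ⟩ := exists_perm_of_image_subset hE h
  have hcard : Fintype.card {x // x ∈ E.image Prod.fst} = E.card := by
    rw [Fintype.card_coe, Finset.card_image_of_injOn hE.1]
  obtain ⟨c, hc⟩ := exists_sum_schur (d := E.card) (cyclePowerSum σ) fun N => by
    rw [cyclePowerSum_apply, ← hcard]
    exact colourSum_isHomogeneous σ N
  refine ⟨fun n => ∑ lam, c lam • stripSum lam n,
    StablyExpands.sum _ _ fun lam _ => (stablyExpands_stripSum lam M).smul _, fun n hM hn => ?_⟩
  refine Lambda.ext_of_le (n + 1) fun N hN => ?_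
  obtain ⟨N, rfl⟩ : ∃ N', N = N' + 1 := ⟨N - 1, by omega⟩
  rw [← Lambda.eval_apply, ← Lambda.eval_apply]
  rw [extensionSum_of_perm (fun e he => Finset.Icc_subset_Icc_right hM (hEM e he)) σ hσ hE, hc]
  simp only [map_smul, map_sum, Finset.sum_mul, smul_mul_assoc]
  congr 1
  refine Finset.sum_congr rfl fun lam _ => ?_
  rw [stripSum_apply lam hn (by omega), mul_comm]

/-- The number of points that a partial bijection involves. -/
def supportCard (E : Finset (ℕ × ℕ)) : ℕ := (E.image Prod.fst ∪ E.image Prod.snd).card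

/-- Strong induction on the number of vertices: the recursion of `extensionSum_erase` expresses the
sum for `E` through graphs with fewer vertices, down to those consisting of cycles. -/
theorem exists_stablyExpands {M : ℕ} (E : Finset (ℕ × ℕ)) (hE : IsPartialBij E)
    (hEM : ∀ e ∈ E, e.1 ∈ Finset.Icc 1 M ∧ e.2 ∈ Finset.Icc 1 M) :
    ∃ T, StablyExpands E.card M T ∧ ∀ n, M ≤ n → 2 * E.card ≤ n →
      extensionSum n E = ((n - supportCard E)! : ℂ) • T n := by
  induction hm : supportCard E using Nat.strong_induction_on generalizing E with
  | _ m ih =>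
  by_cases hsub : E.image Prod.snd ⊆ E.image Prod.fst
  · have h1 : supportCard E = E.card := by
      rw [supportCard, Finset.union_eq_left.2 hsub, Finset.card_image_of_injOn hE.1]
    rw [← hm, h1]
    exact exists_stablyExpands_of_perm hE (fun e he => (hEM e he).1) hsub
  -- The vertex y is the end of a path, and x is its predecessor.
  obtain ⟨y, hyJ, hy⟩ := Finset.not_subset.1 hsub
  obtain ⟨⟨x, y'⟩, hxy, rfl⟩ := Finset.mem_image.1 hyJ
  simp only at hy
  set E' := E.erase (x, y') with hE'
  have hins : insert (x, y') E' = E := Finset.insert_erase hxy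
  have hcard : E'.card + 1 = E.card := Finset.card_erase_add_one hxy
  have hE's : E' ⊆ E := Finset.erase_subset _ _
  have hE'b : IsPartialBij E' := ⟨hE.1.mono hE's, hE.2.mono hE's⟩
  set I := E.image Prod.fst with hI
  set J' := E'.image Prod.snd with hJ'
  have hx : x ∈ I := Finset.mem_image_of_mem Prod.fst hxy
  have hJ : E.image Prod.snd = insert y' J' := by rw [← hins, Finset.image_insert]
  have hII : I = insert x (E'.image Prod.fst) := by rw [hI, ← hins, Finset.image_insert]
  have hyJ' : y' ∉ J' := by
    intro h
    obtain ⟨e, he, he'⟩ := Finset.mem_image.1 h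
    exact (Finset.mem_erase.1 he).1 (hE.2 (hE's he) hxy he')
  have hxI' : x ∉ E'.image Prod.fst := by
    intro h
    obtain ⟨e, he, he'⟩ := Finset.mem_image.1 h
    exact (Finset.mem_erase.1 he).1 (hE.1 (hE's he) hxy he')
  have hmu : supportCard E = (I ∪ J').card + 1 := by
    rw [supportCard, hJ, Finset.union_insert, Finset.card_insert_of_notMem]
    exact fun h => (Finset.mem_union.1 h).elim hy hyJ'
  have hmM : supportCard E ≤ M := by
    have : E.image Prod.fst ∪ E.image Prod.snd ⊆ Finset.Icc 1 M := by
      intro a ha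
      rcases Finset.mem_union.1 ha with h | h
      · obtain ⟨e, he, rfl⟩ := Finset.mem_image.1 h
        exact (hEM e he).1
      · obtain ⟨e, he, rfl⟩ := Finset.mem_image.1 h
        exact (hEM e he).2
    simpa [supportCard] using Finset.card_le_card this
  -- Redirecting x to the start z of a path keeps the number of edges and loses exactly the vertex
  -- y.
  have hz : ∀ z ∈ I \ E.image Prod.snd, ∃ T, StablyExpands E.card M T ∧ ∀ n, M ≤ n →
      2 * E.card ≤ n →
      extensionSum n (insert (x, z) E') = ((n - (m - 1))! : ℂ) • T n := by
    intro z hz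
    rw [Finset.mem_sdiff] at hz
    have hzJ' : z ∉ J' := fun h => hz.2 (by rw [hJ]; exact Finset.mem_insert_of_mem h)
    have hzE' : (x, z) ∉ E' := fun h => hzJ' (Finset.mem_image_of_mem Prod.snd h)
    have hc : (insert (x, z) E').card = E.card := by
      rw [Finset.card_insert_of_notMem hzE', hcard]
    have hs : supportCard (insert (x, z) E') = m - 1 := by
      rw [supportCard, Finset.image_insert, Finset.image_insert, ← hII, Finset.union_insert,
        Finset.insert_eq_of_mem (Finset.mem_union_left _ hz.1), ← hJ']
      omega
    have hb : IsPartialBij (insert (x, z) E') := by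
      constructor
      · rw [Finset.coe_insert, Set.injOn_insert (by exact_mod_cast hzE')]
        exact ⟨hE'b.1, fun h => hxI' (by exact_mod_cast h)⟩
      · rw [Finset.coe_insert, Set.injOn_insert (by exact_mod_cast hzE')]
        exact ⟨hE'b.2, fun h => hzJ' (by exact_mod_cast h)⟩
    have hM : ∀ e ∈ insert (x, z) E', e.1 ∈ Finset.Icc 1 M ∧ e.2 ∈ Finset.Icc 1 M := by
      intro e he
      rcases Finset.mem_insert.1 he with rfl | h
      · obtain ⟨e', he', h'⟩ := Finset.mem_image.1 hz.1
        refine ⟨(hEM _ hxy).1, ?_⟩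
        rw [← h']
        exact (hEM e' he').1
      · exact hEM e (hE's h)
    have := ih (m - 1) (by omega) _ hb hM hs
    rwa [hc] at this
  have hz' : ∀ z, ∃ T : ℕ → Lambda, z ∈ I \ E.image Prod.snd → StablyExpands E.card M T ∧
      ∀ n, M ≤ n → 2 * E.card ≤ n →
      extensionSum n (insert (x, z) E') = ((n - (m - 1))! : ℂ) • T n := by
    intro z
    by_cases h : z ∈ I \ E.image Prod.snd
    · obtain ⟨T, hT⟩ := hz z h
      exact ⟨T, fun _ => hT⟩
    · exact ⟨0, fun h' => absurd h' h⟩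
  choose T hT using hz'
  obtain ⟨S, hS, hS'⟩ : ∃ S, StablyExpands E.card M S ∧ ∀ n, M ≤ n → 2 * E.card ≤ n →
      extensionSum n E' = ((n - (m - 1))! : ℂ) • S n := by
    have hE'M : ∀ e ∈ E', e.1 ∈ Finset.Icc 1 M ∧ e.2 ∈ Finset.Icc 1 M := fun e he =>
      hEM e (hE's he)
    rw [← hcard]
    -- If x has a predecessor, deleting the edge loses only the vertex y; otherwise x becomes
    -- isolated and is lost too. In the first case the factor 1 merely relaxes the bounds from k - 1
    -- edges to k.
    by_cases hxJ : x ∈ J'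
    · have hs : supportCard E' = m - 1 := by
        rw [hII, Finset.insert_union, Finset.insert_eq_of_mem (Finset.mem_union_right _ hxJ)] at hmu
        rw [supportCard, ← hJ']
        omega
      obtain ⟨T', h1, h2⟩ := ih (m - 1) (by omega) E' hE'b hE'M hs
      refine ⟨fun n => Polynomial.eval (n : ℂ) 1 • T' n, h1.eval_smul 1 (by simp),
        fun n hM hn => ?_⟩
      simp only [h2 n hM (by omega), Polynomial.eval_one, one_smul]
    · have hs : supportCard E' + 2 = m := by
        rw [hII, Finset.insert_union, Finset.card_insert_of_notMem (by simp [hxI', hxJ])] at hmu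
        rw [supportCard, ← hJ']
        omega
      obtain ⟨T', h1, h2⟩ := ih (m - 2) (by omega) E' hE'b hE'M (by omega)
      -- The linear polynomial is n - m + 2, the quotient of (n-m+2)! by (n-m+1)!.
      refine ⟨fun n => Polynomial.eval (n : ℂ)
        (Polynomial.X - Polynomial.C ((m - 2 : ℕ) : ℂ)) • T' n,
        h1.eval_smul _ (Polynomial.natDegree_X_sub_C_le _), fun n hM hn => ?_⟩
      beta_reduce
      rw [h2 n hM (by omega), smul_smul]
      congr 1
      obtain ⟨t, rfl⟩ : ∃ t, n = t + m := ⟨n - m, by omega⟩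
      rw [show t + m - (m - 2) = t + 1 + 1 by omega, show t + m - (m - 1) = t + 1 by omega,
        Nat.factorial_succ (t + 1), Polynomial.eval_sub, Polynomial.eval_X, Polynomial.eval_C,
        Nat.cast_sub (by omega : 2 ≤ m)]
      push_cast
      ring
  refine ⟨fun n => S n + (-1 : ℂ) • ∑ z ∈ I \ E.image Prod.snd, T z n,
    hS.add ((StablyExpands.sum _ _ fun z h => (hT z h).1).smul _), fun n hM hn => ?_⟩
  have hrec := extensionSum_erase hE (fun e he =>
    ⟨Finset.Icc_subset_Icc_right hM (hEM e he).1, Finset.Icc_subset_Icc_right hM (hEM e he).2⟩)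
    hxy hy
  rw [← hE', ← hI, ← hJ', hS' n hM hn,
    Finset.sum_congr rfl fun z h => (hT z h).2 n hM hn, ← Finset.smul_sum] at hrec
  obtain ⟨t, rfl⟩ : ∃ t, n = t + m := ⟨n - m, by omega⟩
  rw [show t + m - (m - 1) = t + 1 by omega, show t + m - (I ∪ J').card = t + 1 by omega,
    ← Nat.cast_smul_eq_nsmul ℂ] at hrec
  have ht : ((t + 1 : ℕ) : ℂ) ≠ 0 := Nat.cast_ne_zero.2 (Nat.succ_ne_zero t)
  -- With t = n - m, the recursion determines (t+1) times the sum for `E`; cancelling t + 1 leaves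
  -- the prefactor t!.
  refine smul_right_injective Lambda ht ?_
  change ((t + 1 : ℕ) : ℂ) • extensionSum (t + m) E = ((t + 1 : ℕ) : ℂ) • _
  rw [eq_sub_of_add_eq hrec.symm, smul_smul, Nat.add_sub_cancel, ← Nat.cast_mul,
    ← Nat.factorial_succ, smul_add, neg_one_smul, smul_neg, sub_eq_add_neg]

/-! ### Atomic symmetric functions as extension sums. -/

/-- For each fixed v in the Reynolds average, substituting w by v w v⁻¹ leaves p_{cyc(w)} unchanged.
All n! terms therefore agree, and the two factors 1/n! cancel. -/
theorem atomic_eq_extensionSum {n k : ℕ} (I J : Fin k → Finset.Icc 1 n) :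
    atomic n I J =
      extensionSum n (Finset.univ.image fun p => ((I p : ℕ), (J p : ℕ))) := by
  classical
  have hn : (n ! : ℂ) ≠ 0 := Nat.cast_ne_zero.2 n.factorial_ne_zero
  have h1 : ∀ v : SymGroup n, ∑ w : SymGroup n, indicator n I J (v⁻¹ * w * v) • cyclePowerSum w =
      extensionSum n (Finset.univ.image fun p => ((I p : ℕ), (J p : ℕ))) := by
    intro v
    rw [extensionSum, Finset.sum_filter]
    refine Finset.sum_bij (fun w _ => v⁻¹ * w * v) (fun _ _ => Finset.mem_univ _)
      (fun _ _ _ _ h => mul_left_cancel (mul_right_cancel h))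
      (fun u _ => ⟨v * u * v⁻¹, Finset.mem_univ _, by simp [mul_assoc]⟩) fun w _ => ?_
    have h2 : Extends (Finset.univ.image fun p => ((I p : ℕ), (J p : ℕ))) (v⁻¹ * w * v) ↔
        ∀ p, (v⁻¹ * w * v) (I p) = J p := by
      refine ⟨fun h p => h _ _ (Finset.mem_image_of_mem _ (Finset.mem_univ p)), fun h a b hab => ?_⟩
      obtain ⟨p, -, hp⟩ := Finset.mem_image.1 hab
      rw [Prod.mk.injEq] at hp
      rw [← Subtype.ext hp.1, ← Subtype.ext hp.2]
      exact h p
    have h3 := cyclePowerSum_conj w v⁻¹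
    rw [inv_inv] at h3
    rw [h3, indicator]
    simp only [h2]
    split_ifs <;> simp
  have h4 : ∑ w : SymGroup n, ((reynolds n (indicator n I J) : ClassFun (SymGroup n)) :
      SymGroup n → ℂ) w • powerSumPartition w.partition =
      extensionSum n (Finset.univ.image fun p => ((I p : ℕ), (J p : ℕ))) := by
    have h5 : ∀ w : SymGroup n, ((reynolds n (indicator n I J) : ClassFun (SymGroup n)) :
      SymGroup n → ℂ) w • powerSumPartition w.partition = (1 / (n ! : ℂ)) •
        ∑ v : SymGroup n, indicator n I J (v⁻¹ * w * v) • cyclePowerSum w := by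
      intro w
      rw [← Finset.sum_smul, smul_smul]
      rfl
    rw [Finset.sum_congr rfl fun w _ => h5 w, ← Finset.smul_sum, Finset.sum_comm,
      Finset.sum_congr rfl fun v _ => h1 v, Finset.sum_const, Finset.card_univ, Fintype.card_perm,
      Fintype.card_coe, Nat.card_Icc, Nat.add_sub_cancel, ← Nat.cast_smul_eq_nsmul ℂ, smul_smul,
      one_div, inv_mul_cancel₀ hn, one_smul]
  rw [atomic, frobeniusCh, smul_smul, mul_one_div_cancel hn, one_smul, h4]

end SymFun

end

theorem mainTheorem3 (k : ℕ) (I J : Fin k → ℕ) (hI : Function.Injective I)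
    (hJ : Function.Injective J) (hI1 : ∀ p, 1 ≤ I p) (hJ1 : ∀ p, 1 ≤ J p) :
    ∃ c : (j : ℕ) → j.Partition → Polynomial ℂ,
      (∀ (j : ℕ) (μ : j.Partition), j ≤ k → (c j μ).natDegree ≤ k - j) ∧
      ∀ (n : ℕ) (hIn : ∀ p, I p ≤ n) (hJn : ∀ p, J p ≤ n) (hn : 2 * k ≤ n),
        SymFun.atomic n (fun p => ⟨I p, Finset.mem_Icc.2 ⟨hI1 p, hIn p⟩⟩)
            (fun p => ⟨J p, Finset.mem_Icc.2 ⟨hJ1 p, hJn p⟩⟩) =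
          ((n - (Finset.univ.image I ∪ Finset.univ.image J).card)! : ℂ) •
            ∑ j : Fin (k + 1), ∑ μ : (j : ℕ).Partition,
              (c j μ).eval (n : ℂ) •
                SymFun.schur (SymFun.padded μ n (SymFun.add_row_zero_le μ j.2 hn)) := by
  classical
  let E : Finset (ℕ × ℕ) := Finset.univ.image fun p => (I p, J p)
  have hE : SymFun.IsPartialBij E := by
    constructor
    · rintro e he e' he' h
      obtain ⟨p, -, rfl⟩ := Finset.mem_image.1 he
      obtain ⟨q, -, rfl⟩ := Finset.mem_image.1 he'
      rw [hI h]
    · rintro e he e' he' h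
      obtain ⟨p, -, rfl⟩ := Finset.mem_image.1 he
      obtain ⟨q, -, rfl⟩ := Finset.mem_image.1 he'
      rw [hJ h]
  have hcard : E.card = k := by
    rw [Finset.card_image_of_injective _ fun p q h => hI (congrArg Prod.fst h)]
    simp
  have hsupp : SymFun.supportCard E = (Finset.univ.image I ∪ Finset.univ.image J).card := by
    rw [SymFun.supportCard, Finset.image_image, Finset.image_image]
    rfl
  -- The coefficients must be chosen before n, so `M` is the least bound that every admissible n
  -- satisfies; it is 0 when k = 0.
  let M := max (Finset.univ.sup I) (Finset.univ.sup J)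
  obtain ⟨T, ⟨c, hc, hT⟩, hT'⟩ := SymFun.exists_stablyExpands (M := M) E hE (by
    intro e he
    obtain ⟨p, -, rfl⟩ := Finset.mem_image.1 he
    exact ⟨Finset.mem_Icc.2 ⟨hI1 p, (Finset.le_sup (Finset.mem_univ p)).trans (le_max_left _ _)⟩,
      Finset.mem_Icc.2 ⟨hJ1 p, (Finset.le_sup (Finset.mem_univ p)).trans (le_max_right _ _)⟩⟩)
  rw [hcard] at hc hT hT'
  refine ⟨c, hc, fun n hIn hJn hn => ?_⟩
  have hM : M ≤ n := max_le (Finset.sup_le fun p _ => hIn p) (Finset.sup_le fun p _ => hJn p)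
  rw [SymFun.atomic_eq_extensionSum, ← hsupp]
  refine (hT' n hM hn).trans ?_
  rw [hT n hM hn, Finset.sum_range]
  congr 1
  refine Finset.sum_congr rfl fun j _ => Finset.sum_congr rfl fun μ _ => ?_
  rw [SymFun.paddedSchur, dif_pos (SymFun.add_row_zero_le μ j.2 hn)]
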